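/- **Model.** A principal chooses once, irrevocably and at a time of her choice, between a safe action (payoff $\theta$ to her, $\beta$ to the agent) and a risky action (payoff $\omega\in\{0,1\}$ to both), where $\Pr(\omega=1)=\mu$ and $0<\beta<\mu<\theta<1$; both players discount at rate $\rho>0$. Real news, which reveals $\omega$ (type-$\omega$ news), arrives at a random time independent of $\omega$ with distribution function $G$ on $[0,\infty)$, $G(0)=0$, $G<1$, $G$ differentiable with derivative $g$ (possibly $\lim_{t\to\infty}G(t)<1$: real news may never arrive), and strictly decreasing hazard rate $H_R=g/(1-G)$. With prior probability $\sigma\in(0,1)$ the agent is of the manipulative type, who can generate at one time a fake type-1 arrival that is indistinguishable from real type-1 news. News arrives only once, and the principal acts when it arrives. Let $$\phi_P=\frac{\rho\theta}{\mu(1-\theta)},\qquad \phi_A=\frac{\rho\mu}{\beta(1-\mu)},$$ and assume (A1) $H_R(0)>\phi_P>\lim_{t\to\infty}H_R(t)$ and (A2) $\phi_P>\phi_A$. With $(d_P,s_P)=(\theta,\theta)$ and $(d_A,s_A)=(\mu,\beta)$, player $i$'s first-best payoff of search duration $t$ is $$u_i^{FB}(t)=\int_0^t e^{-\rho x}g(x)\big(\mu+(1-\mu)s_i\big)\,dx+e^{-\rho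 t}(1-G(t))\,d_i ,$$ and $\tau_P$ denotes the maximizer of $u_P^{FB}$ on $[0,\infty)$. **Strategies.** The manipulative agent's faking time and the principal's stopping time (at which she selects safe) are drawn from probability distributions on $[0,\infty]$ with distribution functions $F_A$, $F_P$, each the sum of an absolutely continuous part, with a density $f_A$, resp. $f_P$, specified at every time, and of atoms. After type-0 news the principal selects safe; after type-1 news at $t$ she selects risky with probability $a(t)\in[0,1]$. Safe is selected if stopping and faking coincide in time. The belief $\mu_1(t)$ that $\omega=1$ after type-1 news at $t$ is $\mu$ if $F_A$ has an atom at $t$, and otherwise $$\mu_1(t)=\frac{\mu g(t)(1-\sigma F_A(t))+\mu\sigma f_A(t)(1-G(t))}{\mu g(t)(1-\sigma F_A(t))+\sigma f_A(t)(1-G(t))}.$$ The principal's expected payoff of stopping at $t$ is $$u_P(t)=\int_{[0,t]} e^{-\rho s}\Big\{(1-\mu)g(s)(1-\sigma F_A(s))\theta\,ds+\big[\mu g(s)(1-\sigma F_A(s))\,ds+\sigma(1-G(s))\,dF_A(s)\big]\big[(1-a(s))\theta+a(s)\mu_1(s)\big]\Big\}+e^{-\rho t}(1-G(t))(1-\sigma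 F_A(t))\theta,$$ and the manipulative agent's expected payoff of faking at $t$ is $$u_A(t)=\int_{[0,t]} e^{-\rho s}\Big\{(1-F_P(s))g(s)\big[(1-\mu)\beta+\mu((1-a(s))\beta+a(s))\big]ds+\beta(1-G(s))\,dF_P(s)\Big\}+e^{-\rho t}(1-G(t))(1-F_P(t))\big[(1-a(t))\beta+\mu a(t)\big];$$ at $t=\infty$ the integrals are over $[0,\infty)$ and the last terms are absent. **Equilibrium.** A profile $(a,F_P,F_A)$ is an equilibrium if (i) every $t\in[0,\infty]$ at which $F_A$ has an atom or $f_A(t)>0$ maximizes $u_A$ over $[0,\infty]$; (ii) for all $t\ge0$, $a(t)=1$ if $\mu_1(t)>\theta$ and $a(t)=0$ if $\mu_1(t)<\theta$; (iii) every $t\in[0,\infty]$ at which $F_P$ has an atom or $f_P(t)>0$ maximizes $u_P$ over $[0,\infty]$. Equilibrium payoffs are the expectations of $u_P$ under $F_P$ and of $u_A$ under $F_A$. The equilibrium has beneficial search if the principal's equilibrium payoff exceeds $\theta$. **Proposition (Equilibrium With Beneficial Search).** An equilibrium with beneficial search exists if and only if $\sigma<\bar\sigma$, where $$\bar\sigma=1-\exp\Big\{-\int_0^{\tau_P}\frac{\mu(1-\theta)H_R(s)-\rho\theta}{\theta-\mu}\,ds\Big\}.$$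 In such an equilibrium the faking and stopping strategies are $$F_A(t)=\frac1\sigma\Big(1-\exp\Big\{-\int_{\tau_M}^t\frac{\mu(1-\theta)H_R(s)-\rho\theta}{\theta-\mu}\,ds\Big\}\Big)\quad\text{for } t\in[\tau_M,\tau_P],$$ $$F_P(t)=1-\exp\Big\{-\int_{\tau_M}^t\frac{\beta(1-\mu)H_R(s)-\rho\mu}{\mu-\beta}\,ds\Big\}\quad\text{for } t\in[\tau_M,\tau_P),\qquad F_P(\tau_P)=1,$$ both supported on $[\tau_M,\tau_P]$, with an atom of $F_P$ at $\tau_P$, where $\tau_M\in(0,\tau_P)$ is the unique value in $[0,\tau_P]$ for which $$1-\exp\Big\{-\int_{\tau_M}^{\tau_P}\frac{\mu(1-\theta)H_R(s)-\rho\theta}{\theta-\mu}\,ds\Big\}=\sigma .$$ The equilibrium payoff of player $i\in\{A,P\}$ is $u_i^{FB}(\tau_M)$. No other equilibrium with beneficial search exists: any two such equilibria have the same $F_A$, the same $F_P$ and the same $a(t)$ for all $t\ge0$. -/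

import Mathlib

open Real Set Filter Topology MeasureTheory

noncomputable section

/-- Primitives of the game. `θ` and `β` are the payoffs of the safe action to the principal and to
the agent, `μ` the prior probability that the risky payoff is one, `ρ` the discount rate, `σ` the
prior probability of the manipulative agent. The arrival time of real news has the distribution
function `G` with `G' = g` on `[0, ∞)` and a strictly decreasing hazard rate. The limit of `G` at
infinity may be smaller than one: then real news never arrives with positive probability. -/
structure SearchModel where
  θ : ℝ
  β : ℝ
  μ : ℝ
  ρ : ℝ
  σ : ℝ
  G : ℝ → ℝ
  g : ℝ → ℝ
  θ_lt_one : θ < 1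
  β_pos : 0 < β
  β_lt_μ : β < μ
  μ_lt_θ : μ < θ
  ρ_pos : 0 < ρ
  σ_pos : 0 < σ
  σ_lt_one : σ < 1
  G_zero : G 0 = 0
  G_lt_one : ∀ t, 0 ≤ t → G t < 1
  g_nonneg : ∀ t, 0 ≤ t → 0 ≤ g t
  G_hasDeriv : ∀ t, 0 ≤ t → HasDerivWithinAt G (g t) (Ici 0) t
  hazard_strictAnti : StrictAntiOn (fun t => g t / (1 - G t)) (Ici 0)

/-- A mixed strategy over times in `[0, ∞]` that has an absolutely continuous component, with
density `dens`, and a discrete component, with an atom of size `atom t` at each finite time `t`.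
The remaining mass is an atom at infinity. -/
structure MixedTime where
  dens : ℝ → ℝ
  atom : ℝ → ℝ
  dens_nonneg : ∀ t, 0 ≤ dens t
  atom_nonneg : ∀ t, 0 ≤ atom t
  dens_of_neg : ∀ t, t < 0 → dens t = 0
  atom_of_neg : ∀ t, t < 0 → atom t = 0
  dens_measurable : Measurable dens
  dens_integrable : Integrable dens
  atom_summable : Summable atom
  mass_le_one : (∫ t, dens t) + (∑' t, atom t) ≤ 1

namespace MixedTime

/-- The probability of the time infinity. -/
def never (S : MixedTime) : ℝ := 1 - ((∫ t, S.dens t) + (∑' t, S.atom t))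

/-- The cumulative distribution function. -/
def cdf (S : MixedTime) (t : ℝ) : ℝ :=
  (∫ s in Iic t, S.dens s) + (∑' s, if s ≤ t then S.atom s else 0)

/-- The finite time `t` carries probability density or probability mass. -/
def Charges (S : MixedTime) (t : ℝ) : Prop := 0 < S.dens t ∨ 0 < S.atom t

/-- The support: the times all of whose neighbourhoods have positive probability. -/
def support (S : MixedTime) : Set ℝ := {t | ∀ ε > 0, S.cdf (t - ε) < S.cdf (t + ε)}

/-- Expected payoff of the mixed strategy, if the finite time `t` gives payoff `u t` and the time
infinity gives payoff `uInf`. -/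
def expected (S : MixedTime) (u : ℝ → ℝ) (uInf : ℝ) : ℝ :=
  (∫ t, S.dens t * u t) + (∑' t, S.atom t * u t) + S.never * uInf

/-- Every time in `[0, ∞]` that the strategy charges gives the largest payoff among all times in
`[0, ∞]`. -/
def Optimal (S : MixedTime) (u : ℝ → ℝ) (uInf : ℝ) : Prop :=
  (∀ t, 0 ≤ t → S.Charges t → (∀ t', 0 ≤ t' → u t' ≤ u t) ∧ uInf ≤ u t) ∧
  (0 < S.never → ∀ t', 0 ≤ t' → u t' ≤ uInf)

end MixedTime

/-- A strategy profile: `act t` is the probability with which the principal selects the risky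
action when type-1 news arrives at `t`, `stopTime` is her mixed stopping time, and `fakeTime` is the mixed
faking time of the manipulative agent. -/
structure Profile where
  act : ℝ → ℝ
  act_mem : ∀ t, act t ∈ Icc (0 : ℝ) 1
  act_measurable : Measurable act
  stopTime : MixedTime
  fakeTime : MixedTime

namespace SearchModel

variable (M : SearchModel)

/-- Hazard rate of real news. -/
def hazard (t : ℝ) : ℝ := M.g t / (1 - M.G t)

def phiP : ℝ := M.ρ * M.θ / (M.μ * (1 - M.θ))

def phiA : ℝ := M.ρ * M.μ / (M.β * (1 - M.μ))

/-- `H_R(0) > φ_P > H_R(∞)`. -/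
def A1 : Prop :=
  M.phiP < M.hazard 0 ∧ ∃ h : ℝ, Tendsto M.hazard atTop (𝓝 h) ∧ h < M.phiP

/-- `φ_P > φ_A`. -/
def A2 : Prop := M.phiA < M.phiP

/-- First-best payoff of the search duration `t` for a player with payoff `s` of the safe action
and payoff `d` of the default action. -/
def firstBest (s d t : ℝ) : ℝ :=
  (∫ x in (0 : ℝ)..t, exp (-M.ρ * x) * M.g x * (M.μ + (1 - M.μ) * s))
    + exp (-M.ρ * t) * (1 - M.G t) * d

/-- The default action of the principal is safe. -/
def firstBestP (t : ℝ) : ℝ := M.firstBest M.θ M.θ t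

/-- The default action of the agent is risky. -/
def firstBestA (t : ℝ) : ℝ := M.firstBest M.β M.μ t

/-- `t` is an optimal search duration of the principal in her first-best benchmark. -/
def IsFirstBestDurationP (t : ℝ) : Prop :=
  0 ≤ t ∧ ∀ t', 0 ≤ t' → M.firstBestP t' ≤ M.firstBestP t

/-- Posterior belief that the risky payoff is one, given type-1 news at `t`, when the faking time
has law `A`. Real news has no atoms, hence news at an atom of `A` is fake and leaves the prior. -/
def belief (A : MixedTime) (t : ℝ) : ℝ :=
  open Classical in
  if 0 < A.atom t then M.μ
  else (M.μ * M.g t * (1 - M.σ * A.cdf t) + M.μ * M.σ * A.dens t * (1 - M.G t)) /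
    (M.μ * M.g t * (1 - M.σ * A.cdf t) + M.σ * A.dens t * (1 - M.G t))

/-- Payoff of the principal after type-1 news at `t`. -/
def newsP (E : Profile) (t : ℝ) : ℝ :=
  (1 - E.act t) * M.θ + E.act t * M.belief E.fakeTime t

/-- Discounted payoff density of the principal from news at `s`, atoms of faking left out. -/
def flowP (E : Profile) (s : ℝ) : ℝ :=
  exp (-M.ρ * s) *
    ((1 - M.μ) * M.g s * (1 - M.σ * E.fakeTime.cdf s) * M.θ
      + (M.μ * M.g s * (1 - M.σ * E.fakeTime.cdf s) + M.σ * E.fakeTime.dens s * (1 - M.G s))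
        * M.newsP E s)

/-- Discounted payoff of the principal from an atom of faking at `s`. -/
def lumpP (E : Profile) (s : ℝ) : ℝ :=
  exp (-M.ρ * s) * (M.σ * E.fakeTime.atom s * (1 - M.G s)) * M.newsP E s

/-- Expected payoff of the principal if she waits for news until `t`. -/
def uP (E : Profile) (t : ℝ) : ℝ :=
  (∫ s in (0 : ℝ)..t, M.flowP E s) + (∑' s, if s ≤ t then M.lumpP E s else 0)
    + exp (-M.ρ * t) * ((1 - M.G t) * (1 - M.σ * E.fakeTime.cdf t)) * M.θ

/-- Expected payoff of the principal if she waits for news forever. -/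
def uPInf (E : Profile) : ℝ :=
  (∫ s in Ioi (0 : ℝ), M.flowP E s) + (∑' s, M.lumpP E s)

/-- Discounted payoff density of the agent from real news at `s` and from stopping of the
principal at `s`, atoms of stopping left out. -/
def flowA (E : Profile) (s : ℝ) : ℝ :=
  exp (-M.ρ * s) *
    ((1 - M.μ) * M.g s * (1 - E.stopTime.cdf s) * M.β
      + M.μ * M.g s * (1 - E.stopTime.cdf s) * ((1 - E.act s) * M.β + E.act s)
      + E.stopTime.dens s * (1 - M.G s) * M.β)

/-- Discounted payoff of the agent from an atom of stopping at `s`. -/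
def lumpA (E : Profile) (s : ℝ) : ℝ :=
  exp (-M.ρ * s) * (E.stopTime.atom s * (1 - M.G s)) * M.β

/-- Expected payoff of the manipulative agent if he waits until `t` to generate a fake. -/
def uA (E : Profile) (t : ℝ) : ℝ :=
  (∫ s in (0 : ℝ)..t, M.flowA E s) + (∑' s, if s ≤ t then M.lumpA E s else 0)
    + exp (-M.ρ * t) * ((1 - M.G t) * (1 - E.stopTime.cdf t))
      * ((1 - E.act t) * M.β + M.μ * E.act t)

/-- Expected payoff of the manipulative agent if he never fakes. -/
def uAInf (E : Profile) : ℝ :=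
  (∫ s in Ioi (0 : ℝ), M.flowA E s) + (∑' s, M.lumpA E s)

/-- Equilibrium: optimal faking times, optimal response to type-1 news at every time, optimal
stopping times. -/
structure IsEquilibrium (E : Profile) : Prop where
  fakeTime_optimal : E.fakeTime.Optimal (M.uA E) (M.uAInf E)
  act_one : ∀ t, 0 ≤ t → M.θ < M.belief E.fakeTime t → E.act t = 1
  act_zero : ∀ t, 0 ≤ t → M.belief E.fakeTime t < M.θ → E.act t = 0
  stopTime_optimal : E.stopTime.Optimal (M.uP E) (M.uPInf E)

/-- Equilibrium payoff of the principal. -/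
def payoffP (E : Profile) : ℝ := E.stopTime.expected (M.uP E) (M.uPInf E)

/-- Equilibrium payoff of the manipulative agent. -/
def payoffA (E : Profile) : ℝ := E.fakeTime.expected (M.uA E) (M.uAInf E)

/-- An equilibrium in which the principal gains from search: her payoff exceeds the payoff of an
immediate decision under the prior belief. -/
def IsBeneficialEquilibrium (E : Profile) : Prop :=
  M.IsEquilibrium E ∧ M.θ < M.payoffP E

/-- Integrand of the exponent in the faking distribution. -/
def rateA (s : ℝ) : ℝ :=
  (M.μ * (1 - M.θ) * M.hazard s - M.ρ * M.θ) / (M.θ - M.μ)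

/-- Integrand of the exponent in the stopping distribution. -/
def rateP (s : ℝ) : ℝ :=
  (M.β * (1 - M.μ) * M.hazard s - M.ρ * M.μ) / (M.μ - M.β)

/-- Threshold for the prior probability of the manipulative agent, as a function of the hard
deadline `τP`. -/
def sigmaBar (τP : ℝ) : ℝ := 1 - exp (-∫ s in (0 : ℝ)..τP, M.rateA s)

/-- The equation that determines the soft deadline `τ`, given the hard deadline `τP`. -/
def SoftDeadlineEq (τP τ : ℝ) : Prop := 1 - exp (-∫ s in τ..τP, M.rateA s) = M.σ

end SearchModel

end

/-!
Real news has a monotone hazard rate that is also a derivative, hence continuous by Darboux's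
theorem; so the first-best payoffs are integrals of continuous functions, and `τP` is the only zero
of the principal's gain `gainP` from waiting for real news (`gainP_firstBestDuration`).

Integration by parts against the distribution functions (`MixedTime.mul_cdf_eq`) removes all atoms
from the payoffs: `uP t` is `θ` plus the integral of `waitP` up to `t`, and `uA t` is `β` plus the
integral of `waitA`, plus a premium for a fake that is trusted (`uP_eq_and_tendsto`,
`uA_eq_and_tendsto`). News that is worth no more than `θ` contributes nothing to `waitP`, so that
waiting then costs the principal. If `W` is the highest payoff of the agent, the `slack` is `W` minus
`β` and the gains from waiting up to `t`. The premium never exceeds the slack, and equals it at the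
times of faking; at the other times news is certainly real and is trusted. Hence the
principal's trust in news is a function of the slack (`premium_eq_min`).

Uniqueness. After `τP` waiting costs the principal, so she stops by `τP`. She does not stop for sure
earlier, because the agent does not fake when the principal has surely stopped (`uA_lt_of_stopped`),
and without faking she gains from waiting until `τP` (`stop_at_τP`). The crucial step is
`uP_eq_of_fake`: every faking time is an optimal stopping time. At a faking time the slack is at most
the premium of a fully trusted fake. While the principal does not stop, the difference solves a
differential equation that makes it negative from then on, because the agent gains from waiting. So
trust is incomplete, news is worth no more than `θ`, and the principal's payoff falls until the next
optimal stopping time, which is absurd if the faking time was not optimal for her. It follows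
that nobody acts before the first optimal stopping time `τM`, and that the principal's payoff is
constant on `[τM, τP]` (`exists_softDeadline`). Constancy gives the density of faking almost
everywhere (`ae_fake_dens`), and indifference of the agent makes the slack a multiple of the
probability that the principal has not stopped; both solve linear integral equations, whose solutions
are the two exponentials (`noFake_eq`, `stop_cdf_eq`). The agent fakes with probability one by `τP`,
and this is the equation for `τM`; its left-hand side decreases in `τM`, and at zero it is
`sigmaBar τP`.

Existence. The two exponentials define mixed strategies (`MixedTime.exists_of_hazard`), and the payoff
formulas show that they form an equilibrium (`exists_beneficialEquilibrium`).
-/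

noncomputable section

/-! ### Hazard rate and first-best payoffs -/

namespace SearchModel

variable (M : SearchModel)

lemma θ_pos : 0 < M.θ := M.β_pos.trans (M.β_lt_μ.trans M.μ_lt_θ)

lemma μ_pos : 0 < M.μ := M.β_pos.trans M.β_lt_μ

lemma μ_lt_one : M.μ < 1 := M.μ_lt_θ.trans M.θ_lt_one

lemma one_sub_G_pos {t : ℝ} (ht : 0 ≤ t) : 0 < 1 - M.G t := sub_pos.2 (M.G_lt_one t ht)

/-- The hazard rate of real news, continued to negative times by its value at zero. This makes it a
continuous antitone function on the whole line. -/
def haz (t : ℝ) : ℝ := M.hazard (max t 0)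

lemma haz_of_nonneg {t : ℝ} (ht : 0 ≤ t) : M.haz t = M.hazard t := by
  rw [haz, max_eq_left ht]

lemma haz_antitone : Antitone M.haz := fun _ _ h =>
  M.hazard_strictAnti.antitoneOn (mem_Ici.2 (le_max_right _ _)) (mem_Ici.2 (le_max_right _ _))
    (max_le_max_right 0 h)

lemma haz_lt {s t : ℝ} (hs : 0 ≤ s) (h : s < t) : M.haz t < M.haz s := by
  rw [M.haz_of_nonneg hs, M.haz_of_nonneg (hs.trans h.le)]
  exact M.hazard_strictAnti (mem_Ici.2 hs) (mem_Ici.2 (hs.trans h.le)) h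

lemma haz_nonneg (t : ℝ) : 0 ≤ M.haz t :=
  div_nonneg (M.g_nonneg _ (le_max_right _ _)) (M.one_sub_G_pos (le_max_right _ _)).le

lemma haz_pos (t : ℝ) : 0 < M.haz t := by
  have h1 : M.haz (max t 0 + 1) < M.haz (max t 0) := M.haz_lt (le_max_right _ _) (lt_add_one _)
  have h2 : M.haz (max t 0) ≤ M.haz t := M.haz_antitone (le_max_left _ _)
  linarith [M.haz_nonneg (max t 0 + 1)]

lemma haz_le_zero (t : ℝ) : M.haz t ≤ M.haz 0 := by
  rw [haz, ← M.haz_of_nonneg (le_max_right t 0)]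
  exact M.haz_antitone (le_max_right _ _)

lemma g_eq {t : ℝ} (ht : 0 ≤ t) : M.g t = M.haz t * (1 - M.G t) := by
  rw [M.haz_of_nonneg ht, hazard, div_mul_cancel₀ _ (M.one_sub_G_pos ht).ne']

lemma hasDerivWithinAt_neg_log {t : ℝ} (ht : 0 ≤ t) :
    HasDerivWithinAt (fun x => -log (1 - M.G x)) (M.hazard t) (Ici 0) t := by
  refine (((M.G_hasDeriv t ht).const_sub 1).log (M.one_sub_G_pos ht).ne').fun_neg.congr_deriv ?_
  rw [hazard]; ring

/-- The hazard rate is the derivative of `-log (1 - G)`, hence has the intermediate value property;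
a monotone function with this property is continuous. -/
lemma haz_continuous : Continuous M.haz := by
  have hoc : OrdConnected (M.hazard '' Ici 0) :=
    ordConnected_Ici.image_hasDerivWithinAt fun x hx => M.hasDerivWithinAt_neg_log hx
  have hmem : ∀ t, M.haz t ∈ M.hazard '' Ici 0 := fun t =>
    ⟨max t 0, mem_Ici.2 (le_max_right _ _), rfl⟩
  let F : ℝ → (M.hazard '' Ici 0)ᵒᵈ := fun t => OrderDual.toDual ⟨M.haz t, hmem t⟩
  have hF : Continuous F := by
    apply Monotone.continuous_of_surjective
    · intro s t h
      exact M.haz_antitone h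
    · rintro ⟨_, t, ht, rfl⟩
      exact ⟨t, congrArg OrderDual.toDual (Subtype.ext (M.haz_of_nonneg ht))⟩
  exact continuous_subtype_val.comp (continuous_ofDual.comp hF)

/-- The probability that no real news has arrived by `t`, discounted: equal to
`exp (-ρ t) (1 - G t)` for `t ≥ 0`, and continued smoothly to negative times. -/
def disc (t : ℝ) : ℝ := exp (-∫ s in (0 : ℝ)..t, (M.ρ + M.haz s))

lemma disc_pos (t : ℝ) : 0 < M.disc t := exp_pos _

lemma disc_zero : M.disc 0 = 1 := by simp [disc]

lemma continuous_rho_add_haz : Continuous fun s => M.ρ + M.haz s :=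
  continuous_const.add M.haz_continuous

lemma hasDerivAt_disc (t : ℝ) : HasDerivAt M.disc (-((M.ρ + M.haz t) * M.disc t)) t := by
  refine (M.continuous_rho_add_haz.integral_hasStrictDerivAt 0 t).hasDerivAt.fun_neg.exp.congr_deriv
    ?_
  rw [disc]; ring

lemma disc_continuous : Continuous M.disc :=
  continuous_iff_continuousAt.2 fun t => (M.hasDerivAt_disc t).continuousAt

lemma disc_eq {t : ℝ} (ht : 0 ≤ t) : M.disc t = exp (-M.ρ * t) * (1 - M.G t) := by
  have hint : ∫ s in (0 : ℝ)..t, M.haz s = -log (1 - M.G t) := by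
    have h := intervalIntegral.integral_eq_sub_of_hasDerivAt_of_le (f := fun x => -log (1 - M.G x))
      (f' := M.haz) ht
      (fun x hx => ((M.hasDerivWithinAt_neg_log hx.1).mono Icc_subset_Ici_self).continuousWithinAt)
      (fun x hx => by
        rw [M.haz_of_nonneg hx.1.le]
        exact (M.hasDerivWithinAt_neg_log hx.1.le).hasDerivAt (Ici_mem_nhds hx.1))
      (M.haz_continuous.intervalIntegrable _ _)
    rw [h, M.G_zero]; simp
  rw [disc, intervalIntegral.integral_add (continuous_const.intervalIntegrable 0 t)
    (M.haz_continuous.intervalIntegrable _ _), hint,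
    neg_add, neg_neg, exp_add, exp_log (M.one_sub_G_pos ht)]
  simp [mul_comm]

lemma disc_mul_haz {t : ℝ} (ht : 0 ≤ t) : M.disc t * M.haz t = exp (-M.ρ * t) * M.g t := by
  rw [M.disc_eq ht, M.g_eq ht]; ring

lemma disc_le_exp {t : ℝ} (ht : 0 ≤ t) : M.disc t ≤ exp (-M.ρ * t) := by
  have h1 : M.ρ * t ≤ ∫ s in (0 : ℝ)..t, (M.ρ + M.haz s) := by
    have h2 := intervalIntegral.integral_mono_on (μ := volume) (f := fun _ => M.ρ) ht
      (continuous_const.intervalIntegrable 0 t)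
      (M.continuous_rho_add_haz.intervalIntegrable _ _)
      (fun s _ => by linarith [M.haz_nonneg s])
    simpa [mul_comm] using h2
  rw [disc]
  exact exp_le_exp.2 (by linarith)

lemma disc_antitone : Antitone M.disc := by
  refine antitone_of_hasDerivAt_nonpos M.hasDerivAt_disc fun t => ?_
  have := mul_nonneg (add_nonneg M.ρ_pos.le (M.haz_nonneg t)) (M.disc_pos t).le
  simpa using this

lemma tendsto_disc : Tendsto M.disc atTop (𝓝 0) := by
  have h : Tendsto (fun t => exp (-M.ρ * t)) atTop (𝓝 0) :=
    tendsto_exp_atBot.comp (tendsto_id.const_mul_atTop_of_neg (neg_neg_of_pos M.ρ_pos))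
  refine tendsto_of_tendsto_of_tendsto_of_le_of_le' tendsto_const_nhds h
    (Eventually.of_forall fun t => (M.disc_pos t).le) ?_
  filter_upwards [eventually_ge_atTop 0] with t ht using M.disc_le_exp ht

lemma integrableOn_disc : IntegrableOn M.disc (Ioi 0) := by
  refine Integrable.mono' (exp_neg_integrableOn_Ioi 0 M.ρ_pos)
    M.disc_continuous.aestronglyMeasurable ?_
  filter_upwards [ae_restrict_mem measurableSet_Ioi] with t ht
  rw [norm_of_nonneg (M.disc_pos t).le]
  exact M.disc_le_exp (le_of_lt ht)

lemma disc_le_one {t : ℝ} (ht : 0 ≤ t) : M.disc t ≤ 1 := M.disc_zero ▸ M.disc_antitone ht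

lemma integral_deriv_disc (s t : ℝ) :
    ∫ x in s..t, -((M.ρ + M.haz x) * M.disc x) = M.disc t - M.disc s :=
  intervalIntegral.integral_eq_sub_of_hasDerivAt (fun x _ => M.hasDerivAt_disc x)
    ((M.continuous_rho_add_haz.mul M.disc_continuous).neg.intervalIntegrable _ _)

lemma firstBest_eq (s d : ℝ) {t : ℝ} (ht : 0 ≤ t) :
    M.firstBest s d t =
      d + ∫ x in (0 : ℝ)..t, M.disc x *
        (M.haz x * (M.μ + (1 - M.μ) * s) - (M.ρ + M.haz x) * d) := by
  have hc := M.haz_continuous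
  have hd := M.disc_continuous
  have h1 : ∫ x in (0 : ℝ)..t, exp (-M.ρ * x) * M.g x * (M.μ + (1 - M.μ) * s)
      = ∫ x in (0 : ℝ)..t, M.disc x * M.haz x * (M.μ + (1 - M.μ) * s) := by
    refine intervalIntegral.integral_congr fun x hx => ?_
    rw [uIcc_of_le ht] at hx
    simp only [M.disc_mul_haz hx.1]
  have h2 := M.integral_deriv_disc 0 t
  rw [M.disc_zero] at h2
  rw [firstBest, h1, ← M.disc_eq ht]
  have h3 : M.disc t = 1 + ∫ x in (0 : ℝ)..t, -((M.ρ + M.haz x) * M.disc x) := by linarith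
  rw [h3, add_mul, one_mul, ← intervalIntegral.integral_mul_const, add_left_comm,
    ← intervalIntegral.integral_add]
  · congr 2
    ext x
    ring
  all_goals exact Continuous.intervalIntegrable (by fun_prop) _ _

/-- The gain of the principal from waiting an instant for real news, net of discounting. -/
def gainP (t : ℝ) : ℝ := M.μ * (1 - M.θ) * M.haz t - M.ρ * M.θ

/-- The gain of the agent from waiting an instant before risky is selected, net of discounting. -/
def gainA (t : ℝ) : ℝ := M.β * (1 - M.μ) * M.haz t - M.ρ * M.μ

lemma gainP_continuous : Continuous M.gainP := by
  have := M.haz_continuous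
  unfold gainP; fun_prop

lemma gainA_continuous : Continuous M.gainA := by
  have := M.haz_continuous
  unfold gainA; fun_prop

lemma rateA_eq {t : ℝ} (ht : 0 ≤ t) : M.rateA t = M.gainP t / (M.θ - M.μ) := by
  rw [rateA, gainP, M.haz_of_nonneg ht]

lemma rateP_eq {t : ℝ} (ht : 0 ≤ t) : M.rateP t = M.gainA t / (M.μ - M.β) := by
  rw [rateP, gainA, M.haz_of_nonneg ht]

lemma integral_rateA {s t : ℝ} (hs : 0 ≤ s) (ht : 0 ≤ t) :
    ∫ x in s..t, M.rateA x = ∫ x in s..t, M.gainP x / (M.θ - M.μ) := by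
  refine intervalIntegral.integral_congr fun x hx => M.rateA_eq ?_
  exact (le_min hs ht).trans hx.1

lemma integral_rateP {s t : ℝ} (hs : 0 ≤ s) (ht : 0 ≤ t) :
    ∫ x in s..t, M.rateP x = ∫ x in s..t, M.gainA x / (M.μ - M.β) := by
  refine intervalIntegral.integral_congr fun x hx => M.rateP_eq ?_
  exact (le_min hs ht).trans hx.1

lemma firstBestP_eq {t : ℝ} (ht : 0 ≤ t) :
    M.firstBestP t = M.θ + ∫ x in (0 : ℝ)..t, M.disc x * M.gainP x := by
  rw [firstBestP, M.firstBest_eq _ _ ht]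
  congr 2; ext x; rw [gainP]; ring

lemma firstBestA_eq {t : ℝ} (ht : 0 ≤ t) :
    M.firstBestA t = M.μ + ∫ x in (0 : ℝ)..t, M.disc x * M.gainA x := by
  rw [firstBestA, M.firstBest_eq _ _ ht]
  congr 2; ext x; rw [gainA]; ring

lemma disc_gainP_continuous : Continuous fun x => M.disc x * M.gainP x :=
  M.disc_continuous.mul M.gainP_continuous

lemma phiP_lt_iff {x : ℝ} : M.phiP < x ↔ 0 < M.μ * (1 - M.θ) * x - M.ρ * M.θ := by
  have : 0 < M.μ * (1 - M.θ) := mul_pos M.μ_pos (sub_pos.2 M.θ_lt_one)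
  rw [phiP, div_lt_iff₀ this, sub_pos, mul_comm x]

lemma phiA_lt_iff {x : ℝ} : M.phiA < x ↔ 0 < M.β * (1 - M.μ) * x - M.ρ * M.μ := by
  have : 0 < M.β * (1 - M.μ) := mul_pos M.β_pos (sub_pos.2 M.μ_lt_one)
  rw [phiA, div_lt_iff₀ this, sub_pos, mul_comm x]

lemma gainP_lt {s t : ℝ} (hs : 0 ≤ s) (h : s < t) : M.gainP t < M.gainP s := by
  have : 0 < M.μ * (1 - M.θ) := mul_pos M.μ_pos (sub_pos.2 M.θ_lt_one)
  have := mul_lt_mul_of_pos_left (M.haz_lt hs h) this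
  rw [gainP, gainP]; linarith

/-- The gain from waiting crosses zero exactly once, which makes the crossing the only maximizer of
the first-best payoff. -/
lemma gainP_firstBestDuration (hA1 : M.A1) {τP : ℝ} (h : M.IsFirstBestDurationP τP) :
    0 < τP ∧ M.gainP τP = 0 := by
  obtain ⟨h0, l, hl, hlt⟩ := hA1
  have hμ : 0 < M.μ * (1 - M.θ) := mul_pos M.μ_pos (sub_pos.2 M.θ_lt_one)
  have h0' : 0 < M.gainP 0 := by
    rw [gainP, M.haz_of_nonneg le_rfl]; exact M.phiP_lt_iff.1 h0
  obtain ⟨N, hN0, hN⟩ : ∃ N, 0 ≤ N ∧ M.gainP N ≤ 0 := by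
    obtain ⟨N, hN0, hN⟩ := ((eventually_ge_atTop 0).and (hl.eventually_lt_const hlt)).exists
    refine ⟨N, hN0, ?_⟩
    rw [gainP, M.haz_of_nonneg hN0]
    exact not_lt.1 fun h' => lt_asymm hN (M.phiP_lt_iff.2 h')
  obtain ⟨t, ht, ht0⟩ : (0 : ℝ) ∈ M.gainP '' Icc 0 N :=
    intermediate_value_Icc' hN0 M.gainP_continuous.continuousOn ⟨hN, h0'.le⟩
  have htpos : 0 < t := by
    rcases ht.1.eq_or_lt with h' | h'
    · rw [← h'] at ht0; linarith
    · exact h'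
  have hint : ∀ a b, IntervalIntegrable (fun x => M.disc x * M.gainP x) volume a b := fun a b =>
    M.disc_gainP_continuous.intervalIntegrable a b
  have hmax := h.2 t ht.1
  rw [M.firstBestP_eq ht.1, M.firstBestP_eq h.1] at hmax
  have hsub := intervalIntegral.integral_interval_sub_left (hint 0 τP) (hint 0 t)
  have key : τP = t := by
    rcases lt_trichotomy τP t with hlt' | heq | hgt
    · have hp : 0 < ∫ x in τP..t, M.disc x * M.gainP x :=
        intervalIntegral.intervalIntegral_pos_of_pos_on (hint _ _) (fun x hx =>
          mul_pos (M.disc_pos x) (ht0 ▸ M.gainP_lt (h.1.trans hx.1.le) hx.2)) hlt'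
      rw [intervalIntegral.integral_symm] at hp
      linarith
    · exact heq
    · have hp : 0 < ∫ x in t..τP, -(M.disc x * M.gainP x) :=
        intervalIntegral.intervalIntegral_pos_of_pos_on (hint _ _).neg (fun x hx => by
          have := M.gainP_lt ht.1 hx.1
          rw [ht0] at this
          have := mul_neg_of_pos_of_neg (M.disc_pos x) this
          linarith) hgt
      rw [intervalIntegral.integral_neg] at hp
      linarith
  rw [key]
  exact ⟨htpos, ht0⟩

end SearchModel

/-! ### Mixed strategies as measures -/

namespace MixedTime

variable (S : MixedTime)

/-- The finite part of a mixed strategy as a measure on the line. -/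
def law : Measure ℝ :=
  volume.withDensity (fun t => ENNReal.ofReal (S.dens t)) +
    Measure.sum fun s : ℝ => ENNReal.ofReal (S.atom s) • Measure.dirac s

lemma measurable_ofReal_dens : Measurable fun t => ENNReal.ofReal (S.dens t) :=
  S.dens_measurable.ennreal_ofReal

instance : IsFiniteMeasure S.law := by
  constructor
  rw [law, Measure.add_apply, withDensity_apply _ MeasurableSet.univ,
    Measure.sum_apply _ MeasurableSet.univ, ENNReal.add_lt_top]
  constructor
  · rw [Measure.restrict_univ, ← ofReal_integral_eq_lintegral_ofReal S.dens_integrable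
      (Eventually.of_forall S.dens_nonneg)]
    exact ENNReal.ofReal_lt_top
  · have := S.atom_summable.tsum_ofReal_lt_top
    simpa using this

lemma integral_law {h : ℝ → ℝ} (hh : Integrable h S.law) :
    ∫ s, h s ∂S.law = (∫ s, S.dens s * h s) + ∑' s, S.atom s * h s := by
  have hh' := hh
  rw [law, integrable_add_measure] at hh'
  rw [law, integral_add_measure hh'.1 hh'.2,
    integral_withDensity_eq_integral_toReal_smul S.measurable_ofReal_dens (by simp),
    integral_sum_measure hh'.2]
  simp only [integral_smul_measure, integral_dirac, ENNReal.toReal_ofReal (S.dens_nonneg _), ENNReal.toReal_ofReal (S.atom_nonneg _),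
    smul_eq_mul]

lemma setIntegral_law {h : ℝ → ℝ} {A : Set ℝ} (hA : MeasurableSet A) (hh : IntegrableOn h A S.law) :
    ∫ s in A, h s ∂S.law =
      (∫ s in A, S.dens s * h s) + ∑' s, A.indicator (fun s => S.atom s * h s) s := by
  rw [← integral_indicator hA, S.integral_law ((integrable_indicator_iff hA).2 hh),
    ← integral_indicator hA]
  simp only [← Set.indicator_mul_right]

lemma law_real {A : Set ℝ} (hA : MeasurableSet A) :
    S.law.real A = (∫ s in A, S.dens s) + ∑' s, A.indicator S.atom s := by
  have h := S.setIntegral_law (h := fun _ => 1) hA (integrable_const 1)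
  simpa using h

lemma cdf_eq (t : ℝ) : S.cdf t = S.law.real (Iic t) := by
  rw [S.law_real measurableSet_Iic, cdf]
  rfl

lemma law_real_univ : S.law.real univ = 1 - S.never := by
  rw [S.law_real MeasurableSet.univ, never]
  simp

lemma never_nonneg : 0 ≤ S.never := sub_nonneg.2 S.mass_le_one

lemma law_eq_zero {A : Set ℝ} (hA : MeasurableSet A) (h : ∀ t ∈ A, ¬ S.Charges t) :
    S.law.real A = 0 := by
  have hd : ∀ t ∈ A, S.dens t = 0 := fun t ht =>
    le_antisymm (not_lt.1 fun h' => h t ht (Or.inl h')) (S.dens_nonneg t)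
  have ha : ∀ t, A.indicator S.atom t = 0 := fun t => by
    by_cases ht : t ∈ A
    · rw [indicator_of_mem ht]
      exact le_antisymm (not_lt.1 fun h' => h t ht (Or.inr h')) (S.atom_nonneg t)
    · exact indicator_of_notMem ht _
  rw [S.law_real hA, setIntegral_congr_fun hA hd]
  simp [ha]

lemma not_charges_of_neg {t : ℝ} (ht : t < 0) : ¬ S.Charges t := by
  rintro (h | h)
  · exact h.ne' (S.dens_of_neg t ht)
  · exact h.ne' (S.atom_of_neg t ht)

lemma law_singleton (t : ℝ) : S.law.real {t} = S.atom t := by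
  rw [S.law_real (measurableSet_singleton t), tsum_eq_single t]
  · simp
  · intro s hs
    exact indicator_of_notMem (by simpa using hs) _

lemma cdf_mono : Monotone S.cdf := fun s t h => by
  rw [cdf_eq, cdf_eq]
  exact measureReal_mono (Iic_subset_Iic.2 h)

lemma cdf_nonneg (t : ℝ) : 0 ≤ S.cdf t := by rw [cdf_eq]; exact measureReal_nonneg

lemma cdf_le_one (t : ℝ) : S.cdf t ≤ 1 := by
  have h1 := S.law_real_univ
  have h2 := S.never_nonneg
  have h3 : S.law.real (Iic t) ≤ S.law.real univ := measureReal_mono (subset_univ _)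
  rw [cdf_eq]; linarith

lemma cdf_measurable : Measurable S.cdf := S.cdf_mono.measurable

lemma cdf_sub (s t : ℝ) (h : s ≤ t) : S.cdf t - S.cdf s = S.law.real (Ioc s t) := by
  rw [cdf_eq, cdf_eq, ← Iic_union_Ioc_eq_Iic h,
    measureReal_union (Iic_disjoint_Ioc le_rfl) measurableSet_Ioc]
  ring

lemma cdf_of_neg {t : ℝ} (ht : t < 0) : S.cdf t = 0 := by
  rw [cdf_eq]
  exact S.law_eq_zero measurableSet_Iic fun s hs => S.not_charges_of_neg (lt_of_le_of_lt hs ht)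

lemma cdf_rightCts (t : ℝ) : Tendsto S.cdf (𝓝[>] t) (𝓝 (S.cdf t)) := by
  have h := tendsto_measure_biInter_gt (μ := S.law) (s := fun r => Iic r) (a := t)
    (fun _ _ => measurableSet_Iic.nullMeasurableSet) (fun _ _ _ h => Iic_subset_Iic.2 h)
    ⟨t + 1, by simp, measure_ne_top _ _⟩
  have hI : (⋂ r, ⋂ (_ : r > t), Iic r) = Iic t := by
    ext x
    simp only [mem_iInter, mem_Iic]
    exact ⟨fun h => le_of_forall_gt_imp_ge_of_dense h, fun h r hr => h.trans hr.le⟩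
  rw [hI] at h
  have h2 := (ENNReal.tendsto_toReal (measure_ne_top S.law (Iic t))).comp h
  rw [show S.cdf = fun t => (S.law (Iic t)).toReal from funext S.cdf_eq]
  exact h2

/-- A bound on the distribution function to the left of `t` bounds the mass strictly before `t`. -/
lemma cdf_le_add_atom {t c : ℝ} (h : ∀ s < t, S.cdf s ≤ c) : S.cdf t ≤ c + S.atom t := by
  obtain ⟨u, hu, hut, hlim⟩ := exists_seq_strictMono_tendsto t
  have hmono : Monotone fun n => Iic (u n) := fun a b hab => Iic_subset_Iic.2 (hu.monotone hab)
  have hU : (⋃ n, Iic (u n)) = Iio t := by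
    ext x
    simp only [mem_iUnion, mem_Iic, mem_Iio]
    constructor
    · rintro ⟨n, hn⟩; exact hn.trans_lt (hut n)
    · intro hx
      obtain ⟨n, hn⟩ := (hlim.eventually_const_lt hx).exists
      exact ⟨n, hn.le⟩
  have h1 := (ENNReal.tendsto_toReal (measure_ne_top S.law (⋃ n, Iic (u n)))).comp
    (tendsto_measure_iUnion_atTop (μ := S.law) hmono)
  have h2 : S.law.real (Iio t) ≤ c := by
    rw [← hU]
    refine le_of_tendsto h1 (Eventually.of_forall fun n => ?_)
    have := h (u n) (hut n)
    rwa [cdf_eq] at this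
  rw [cdf_eq, ← Iio_union_right, measureReal_union (by simp) (measurableSet_singleton t),
    law_singleton]
  linarith

lemma countable_atoms : {t | S.atom t ≠ 0}.Countable := S.atom_summable.countable_support

lemma ae_atom_eq_zero : ∀ᵐ t, S.atom t = 0 := by
  have h := S.countable_atoms.measure_zero volume
  exact h

lemma ae_law_nonneg (t : ℝ) : ∀ᵐ s ∂(S.law.restrict (Iic t)), s ∈ Icc 0 t := by
  have h0 : S.law.real (Iio 0) = 0 :=
    S.law_eq_zero measurableSet_Iio fun s hs => S.not_charges_of_neg hs
  have h1 : ∀ᵐ s ∂S.law, s ∉ Iio (0 : ℝ) := by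
    rw [← measure_eq_zero_iff_ae_notMem]
    exact (measureReal_eq_zero_iff).1 h0
  filter_upwards [ae_restrict_of_ae h1, ae_restrict_mem measurableSet_Iic] with s hs hs'
  exact ⟨not_lt.1 hs, hs'⟩

/-- Integration by parts against the distribution function of a mixed strategy. -/
lemma mul_cdf_eq {K K' : ℝ → ℝ} (hK : ∀ t, HasDerivAt K (K' t) t) (hK' : Continuous K') {t : ℝ}
    (ht : 0 ≤ t) :
    K t * S.cdf t = (∫ s in (0 : ℝ)..t, K' s * S.cdf s) + (∫ s in (0 : ℝ)..t, K s * S.dens s)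
      + ∑' s, if s ≤ t then K s * S.atom s else 0 := by
  have hKc : Continuous K := continuous_iff_continuousAt.2 fun t => (hK t).continuousAt
  obtain ⟨C, hC⟩ := (isCompact_Icc (a := (0 : ℝ)) (b := t)).exists_bound_of_continuousOn
    hK'.continuousOn
  have hint : Integrable (Function.uncurry fun s x => (Ici s).indicator K' x)
      ((S.law.restrict (Iic t)).prod (volume.restrict (Icc 0 t))) := by
    have hmeas : Measurable (Function.uncurry fun s x : ℝ => (Ici s).indicator K' x) := by
      have : (Function.uncurry fun s x : ℝ => (Ici s).indicator K' x)
          = {p : ℝ × ℝ | p.1 ≤ p.2}.indicator fun p => K' p.2 := by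
        ext ⟨s, x⟩
        simp [indicator]
      rw [this]
      exact (hK'.comp continuous_snd).measurable.indicator
        (measurableSet_le measurable_fst measurable_snd)
    refine Integrable.of_bound hmeas.aestronglyMeasurable C ?_
    have : ∀ᵐ p ∂((S.law.restrict (Iic t)).prod (volume.restrict (Icc 0 t))), p.2 ∈ Icc 0 t :=
      Measure.quasiMeasurePreserving_snd.ae (ae_restrict_mem measurableSet_Icc)
    filter_upwards [this] with p hp
    exact (norm_indicator_le_norm_self _ _).trans (hC _ hp)
  have hswap := integral_integral_swap hint
  have hL : ∫ s in Iic t, (∫ x in Icc 0 t, (Ici s).indicator K' x) ∂S.law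
      = ∫ s in Iic t, (K t - K s) ∂S.law := by
    refine integral_congr_ae ?_
    filter_upwards [S.ae_law_nonneg t] with s hs
    have h1 := intervalIntegral.integral_eq_sub_of_hasDerivAt (fun x (_ : x ∈ uIcc s t) => hK x)
      (hK'.intervalIntegrable _ _)
    rw [← h1, intervalIntegral.integral_of_le hs.2, setIntegral_indicator measurableSet_Ici,
      ← integral_Icc_eq_integral_Ioc]
    congr 2
    ext x
    simp only [mem_inter_iff, mem_Ici, mem_Icc]
    exact ⟨fun h => ⟨h.2, h.1.2⟩, fun h => ⟨⟨hs.1.trans h.1, h.2⟩, h.1⟩⟩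
  have hR : ∫ x in Icc 0 t, (∫ s in Iic t, (Ici s).indicator K' x ∂S.law)
      = ∫ x in (0 : ℝ)..t, K' x * S.cdf x := by
    rw [intervalIntegral.integral_of_le ht, ← integral_Icc_eq_integral_Ioc]
    refine setIntegral_congr_fun measurableSet_Icc fun x hx => ?_
    have : ∀ s, (Ici s).indicator K' x = (Iic x).indicator (fun _ => K' x) s := fun s => by
      simp [indicator]
    simp only [this]
    rw [integral_indicator measurableSet_Iic, Measure.restrict_restrict measurableSet_Iic,
      Iic_inter_Iic, min_eq_left hx.2, setIntegral_const, S.cdf_eq, smul_eq_mul, mul_comm]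
  have hKint : IntegrableOn K (Iic t) S.law := by
    obtain ⟨C', hC'⟩ := (isCompact_Icc (a := (0 : ℝ)) (b := t)).exists_bound_of_continuousOn
      hKc.continuousOn
    refine Integrable.of_bound hKc.aestronglyMeasurable C' ?_
    filter_upwards [S.ae_law_nonneg t] with s hs using hC' s hs
  rw [hL, hR, integral_sub (integrable_const _) hKint, setIntegral_const, ← S.cdf_eq, smul_eq_mul,
    S.setIntegral_law measurableSet_Iic hKint] at hswap
  have hd : ∫ s in Iic t, S.dens s * K s = ∫ s in (0 : ℝ)..t, K s * S.dens s := by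
    rw [intervalIntegral.integral_of_le ht, ← integral_Icc_eq_integral_Ioc]
    refine (setIntegral_eq_of_subset_of_forall_sdiff_eq_zero (s := Icc 0 t) measurableSet_Iic
      Icc_subset_Iic_self fun s hs => ?_).trans (by simp only [mul_comm])
    rw [S.dens_of_neg s (not_le.1 fun h => hs.2 ⟨h, hs.1⟩), zero_mul]
  have ha : ∑' s, (Iic t).indicator (fun s => S.atom s * K s) s
      = ∑' s, if s ≤ t then K s * S.atom s else 0 := by
    refine tsum_congr fun s => ?_
    simp only [indicator, mem_Iic, mul_comm]
  rw [hd, ha] at hswap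
  linarith

variable {S}

/-- All charged times of an optimal mixed strategy give the same payoff, the maximum. -/
lemma Optimal.exists_value {u : ℝ → ℝ} {uInf : ℝ} (h : S.Optimal u uInf) :
    ∃ V, (∀ t, 0 ≤ t → u t ≤ V) ∧ (∀ t, S.Charges t → u t = V) ∧ (0 < S.never → uInf = V) ∧
      S.expected u uInf = V := by
  have nonneg : ∀ {t}, S.Charges t → 0 ≤ t := fun {t} ht =>
    not_lt.1 fun h' => S.not_charges_of_neg h' ht
  obtain ⟨V, h1, h2, h3⟩ : ∃ V, (∀ t, 0 ≤ t → u t ≤ V) ∧ (∀ t, S.Charges t → u t = V) ∧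
      (0 < S.never → uInf = V) := by
    by_cases hc : ∃ t, S.Charges t
    · obtain ⟨t, ht⟩ := hc
      have ht0 := nonneg ht
      refine ⟨u t, (h.1 t ht0 ht).1, fun s hs => ?_, fun hn => ?_⟩
      · exact le_antisymm ((h.1 t ht0 ht).1 s (nonneg hs)) ((h.1 s (nonneg hs) hs).1 t ht0)
      · exact le_antisymm (h.1 t ht0 ht).2 (h.2 hn t ht0)
    · have h0 : S.law.real univ = 0 :=
        S.law_eq_zero MeasurableSet.univ fun t _ ht => hc ⟨t, ht⟩
      rw [law_real_univ] at h0
      have hn : 0 < S.never := by linarith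
      exact ⟨uInf, h.2 hn, fun t ht => (hc ⟨t, ht⟩).elim, fun _ => rfl⟩
  refine ⟨V, h1, h2, h3, ?_⟩
  have e1 : ∀ t, S.dens t * u t = S.dens t * V := fun t => by
    rcases (S.dens_nonneg t).eq_or_lt with h0 | h0
    · rw [← h0, zero_mul, zero_mul]
    · rw [h2 t (Or.inl h0)]
  have e2 : ∀ t, S.atom t * u t = S.atom t * V := fun t => by
    rcases (S.atom_nonneg t).eq_or_lt with h0 | h0
    · rw [← h0, zero_mul, zero_mul]
    · rw [h2 t (Or.inr h0)]
  have e3 : S.never * uInf = S.never * V := by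
    rcases S.never_nonneg.eq_or_lt with h0 | h0
    · rw [← h0, zero_mul, zero_mul]
    · rw [h3 h0]
  rw [expected, e3]
  simp only [e1, e2]
  rw [integral_mul_const, tsum_mul_right, never]
  ring

end MixedTime

/-! ### Payoffs as integrals of the net gain from waiting -/

namespace SearchModel

variable (M : SearchModel)

/-- If `wait` is what remains of the payoff density `flow` once the terms are removed that come from
the decay of a payoff `c` collected at the deadline, then the payoff of a deadline `t` is `c` plus
the integral of `wait`. The atoms of the opponent cancel. -/
lemma payoff_eq_const_add_integral (S : MixedTime) {c e : ℝ} {flow wait lump : ℝ → ℝ}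
    (hw : IntegrableOn wait (Ioi 0))
    (hf : ∀ᵐ s, 0 ≤ s → flow s = wait s + c * ((M.ρ + M.haz s) * M.disc s * (1 - e * S.cdf s))
      + c * e * (M.disc s * S.dens s))
    (hl : ∀ s, lump s = c * e * (M.disc s * S.atom s)) :
    (∀ t, 0 ≤ t → (∫ s in (0 : ℝ)..t, flow s) + (∑' s, if s ≤ t then lump s else 0)
      + c * (M.disc t * (1 - e * S.cdf t)) = c + ∫ s in (0 : ℝ)..t, wait s) ∧
    Tendsto (fun t => (∫ s in (0 : ℝ)..t, flow s) + (∑' s, if s ≤ t then lump s else 0)) atTop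
      (𝓝 ((∫ s in Ioi (0 : ℝ), flow s) + ∑' s, lump s)) := by
  have hKc := M.disc_continuous
  have hhc := M.continuous_rho_add_haz
  have hKF : IntegrableOn (fun s => (M.ρ + M.haz s) * M.disc s * S.cdf s) (Ioi 0) := by
    refine (M.integrableOn_disc.const_mul (M.ρ + M.haz 0)).mono'
      ((hhc.mul hKc).measurable.mul S.cdf_measurable).aestronglyMeasurable
      (Eventually.of_forall fun s => ?_)
    have h1 := M.haz_le_zero s
    have h2 := M.haz_nonneg s
    have h3 := M.disc_pos s
    have h4 : 0 ≤ (M.ρ + M.haz s) * M.disc s := mul_nonneg (by linarith [M.ρ_pos]) h3.le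
    rw [norm_of_nonneg (mul_nonneg h4 (S.cdf_nonneg s))]
    calc (M.ρ + M.haz s) * M.disc s * S.cdf s ≤ (M.ρ + M.haz s) * M.disc s * 1 :=
          mul_le_mul_of_nonneg_left (S.cdf_le_one s) h4
      _ ≤ (M.ρ + M.haz 0) * M.disc s := by
          rw [mul_one]; exact mul_le_mul_of_nonneg_right (by linarith) h3.le
  have hK' : IntegrableOn (fun s => (M.ρ + M.haz s) * M.disc s) (Ioi 0) := by
    refine (M.integrableOn_disc.const_mul (M.ρ + M.haz 0)).mono'
      (hhc.mul hKc).aestronglyMeasurable (Eventually.of_forall fun s => ?_)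
    have h2 := M.haz_nonneg s
    rw [norm_of_nonneg (mul_nonneg (by linarith [M.ρ_pos]) (M.disc_pos s).le)]
    exact mul_le_mul_of_nonneg_right (by linarith [M.haz_le_zero s]) (M.disc_pos s).le
  have hKd : IntegrableOn (fun s => M.disc s * S.dens s) (Ioi 0) := by
    refine S.dens_integrable.integrableOn.mono'
      (hKc.measurable.mul S.dens_measurable).aestronglyMeasurable ?_
    filter_upwards [ae_restrict_mem measurableSet_Ioi] with s hs
    rw [norm_of_nonneg (mul_nonneg (M.disc_pos s).le (S.dens_nonneg s))]
    exact mul_le_of_le_one_left (S.dens_nonneg s) (M.disc_le_one (le_of_lt hs))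
  let rhs : ℝ → ℝ := fun s => wait s + c * ((M.ρ + M.haz s) * M.disc s)
    - c * e * ((M.ρ + M.haz s) * M.disc s * S.cdf s) + c * e * (M.disc s * S.dens s)
  have hae : ∀ᵐ s, s ∈ Ioi (0 : ℝ) → flow s = rhs s := by
    filter_upwards [hf] with s hs h0
    rw [hs (le_of_lt h0)]; simp only [rhs]; ring
  have hrhs : IntegrableOn rhs (Ioi 0) :=
    ((hw.add (hK'.const_mul c)).sub (hKF.const_mul (c * e))).add (hKd.const_mul (c * e))
  have hflow : IntegrableOn flow (Ioi 0) :=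
    hrhs.congr ((ae_restrict_iff' measurableSet_Ioi).2 (by
      filter_upwards [hae] with s hs h0 using (hs h0).symm))
  have ii : ∀ {f : ℝ → ℝ} {t : ℝ}, IntegrableOn f (Ioi 0) → 0 ≤ t →
      IntervalIntegrable f volume 0 t := fun h ht =>
    (intervalIntegrable_iff_integrableOn_Ioc_of_le ht).2 (h.mono_set Ioc_subset_Ioi_self)
  constructor
  · intro t ht
    have h1 : ∫ s in (0 : ℝ)..t, flow s = ∫ s in (0 : ℝ)..t, rhs s := by
      refine intervalIntegral.integral_congr_ae ?_
      filter_upwards [hae] with s hs h0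
      rw [uIoc_of_le ht] at h0
      exact hs h0.1
    have h2 := S.mul_cdf_eq M.hasDerivAt_disc (hhc.mul hKc).neg ht
    have h3 := M.integral_deriv_disc 0 t
    rw [intervalIntegral.integral_neg, M.disc_zero] at h3
    simp only [neg_mul, intervalIntegral.integral_neg] at h2
    have h4 : ∑' s, (if s ≤ t then lump s else 0)
        = c * e * ∑' s, if s ≤ t then M.disc s * S.atom s else 0 := by
      rw [← tsum_mul_left]
      refine tsum_congr fun s => ?_
      rw [hl]; split_ifs <;> simp
    have h5 : ∫ s in (0 : ℝ)..t, rhs s = (∫ s in (0 : ℝ)..t, wait s)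
        + c * (∫ s in (0 : ℝ)..t, (M.ρ + M.haz s) * M.disc s)
        - c * e * (∫ s in (0 : ℝ)..t, (M.ρ + M.haz s) * M.disc s * S.cdf s)
        + c * e * ∫ s in (0 : ℝ)..t, M.disc s * S.dens s := by
      have i1 := ii hw ht
      have i2 := (ii hK' ht).const_mul c
      have i3 := (ii hKF ht).const_mul (c * e)
      have i4 := (ii hKd ht).const_mul (c * e)
      simp only [rhs]
      rw [intervalIntegral.integral_add ((i1.add i2).sub i3) i4,
        intervalIntegral.integral_sub (i1.add i2) i3, intervalIntegral.integral_add i1 i2]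
      simp only [intervalIntegral.integral_const_mul]
    rw [h1, h4, h5]
    linear_combination c * e * (-h2) + (-c) * h3
  · refine (intervalIntegral_tendsto_integral_Ioi 0 hflow tendsto_id).add ?_
    refine tendsto_tsum_of_dominated_convergence (S.atom_summable.mul_left |c * e|)
      (fun s => ?_) (Eventually.of_forall fun t s => ?_)
    · refine tendsto_const_nhds.congr' ?_
      filter_upwards [eventually_ge_atTop s] with t ht
      rw [if_pos ht]
    · have hb : ‖lump s‖ ≤ |c * e| * S.atom s := by
        rw [hl, norm_mul, norm_eq_abs]
        refine mul_le_mul_of_nonneg_left ?_ (abs_nonneg _)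
        rcases lt_or_ge s 0 with h0 | h0
        · rw [S.atom_of_neg s h0]; simp
        · rw [norm_of_nonneg (mul_nonneg (M.disc_pos s).le (S.atom_nonneg s))]
          exact mul_le_of_le_one_left (S.atom_nonneg s) (M.disc_le_one h0)
      split_ifs
      · exact hb
      · rw [norm_zero]; exact (norm_nonneg _).trans hb

variable (E : Profile)

/-- The probability that the agent has not generated a fake by `t`. -/
def noFake (t : ℝ) : ℝ := 1 - M.σ * E.fakeTime.cdf t

lemma noFake_le_one (t : ℝ) : M.noFake E t ≤ 1 := by
  have := mul_nonneg M.σ_pos.le (E.fakeTime.cdf_nonneg t)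
  rw [noFake]; linarith

lemma noFake_pos (t : ℝ) : 0 < M.noFake E t := by
  have := mul_le_of_le_one_right M.σ_pos.le (E.fakeTime.cdf_le_one t)
  rw [noFake]; linarith [M.σ_lt_one]

lemma noFake_measurable : Measurable (M.noFake E) :=
  measurable_const.sub (E.fakeTime.cdf_measurable.const_mul _)

/-- By how much type-1 news at `t` raises the payoff of the principal above `θ`, as a density: the
excess of the belief over `θ` times the density of news, before truncation at zero. -/
def excess (t : ℝ) : ℝ :=
  M.μ * (1 - M.θ) * M.haz t * M.noFake E t - (M.θ - M.μ) * (M.σ * E.fakeTime.dens t)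

/-- The net gain of the principal from waiting an instant at `t`, discounted. -/
def waitP (t : ℝ) : ℝ :=
  M.disc t * (max 0 (M.excess E t) - M.ρ * M.θ * M.noFake E t)

/-- The discounted probability that neither real news nor stopping has occurred by `t`. -/
def alive (t : ℝ) : ℝ := M.disc t * (1 - E.stopTime.cdf t)

/-- The net gain of the agent from waiting an instant at `t`, discounted, when a fake at the
deadline yields `β`. -/
def waitA (t : ℝ) : ℝ :=
  M.alive E t * (M.haz t * M.μ * (1 - M.β) * E.act t - M.ρ * M.β)

variable {E}

lemma excess_le (t : ℝ) : M.excess E t ≤ M.μ * (1 - M.θ) * M.haz t * M.noFake E t := by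
  have := mul_nonneg (sub_pos.2 M.μ_lt_θ).le
    (mul_nonneg M.σ_pos.le (E.fakeTime.dens_nonneg t))
  rw [excess]; linarith

lemma news_coeff_pos (t : ℝ) : 0 < M.μ * (1 - M.θ) * M.haz t * M.noFake E t :=
  mul_pos (mul_pos (mul_pos M.μ_pos (sub_pos.2 M.θ_lt_one)) (M.haz_pos t)) (M.noFake_pos E t)

lemma waitP_le (t : ℝ) : M.waitP E t ≤ M.disc t * (M.gainP t * M.noFake E t) := by
  refine mul_le_mul_of_nonneg_left ?_ (M.disc_pos t).le
  have := max_le (M.news_coeff_pos (E := E) t).le (M.excess_le (E := E) t)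
  rw [gainP]; linarith

lemma integrableOn_waitP : IntegrableOn (M.waitP E) (Ioi 0) := by
  have hm : Measurable (M.waitP E) := by
    have h1 := M.noFake_measurable E
    have h2 := M.haz_continuous.measurable
    have h3 := M.disc_continuous.measurable
    have h4 := E.fakeTime.dens_measurable
    unfold waitP excess
    fun_prop
  refine (M.integrableOn_disc.const_mul (M.μ * (1 - M.θ) * M.haz 0 + M.ρ * M.θ)).mono'
    hm.aestronglyMeasurable (Eventually.of_forall fun t => ?_)
  rw [waitP, norm_mul, norm_of_nonneg (M.disc_pos t).le, mul_comm]
  refine mul_le_mul_of_nonneg_right ?_ (M.disc_pos t).le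
  have hD := M.noFake_pos E t
  have hD1 := M.noFake_le_one E t
  have hρ : 0 < M.ρ * M.θ := mul_pos M.ρ_pos M.θ_pos
  have h1 : M.ρ * M.θ * M.noFake E t ≤ M.ρ * M.θ := mul_le_of_le_one_right hρ.le hD1
  have h2 : 0 ≤ M.ρ * M.θ * M.noFake E t := mul_nonneg hρ.le hD.le
  have h3 := max_le (M.news_coeff_pos (E := E) t).le (M.excess_le (E := E) t)
  have h4 : M.μ * (1 - M.θ) * M.haz t * M.noFake E t ≤ M.μ * (1 - M.θ) * M.haz 0 := by
    have hc : 0 < M.μ * (1 - M.θ) := mul_pos M.μ_pos (sub_pos.2 M.θ_lt_one)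
    calc _ ≤ M.μ * (1 - M.θ) * M.haz t * 1 :=
          mul_le_mul_of_nonneg_left hD1 (mul_pos hc (M.haz_pos t)).le
      _ ≤ _ := by rw [mul_one]; exact mul_le_mul_of_nonneg_left (M.haz_le_zero t) hc.le
  have h5 := le_max_left 0 (M.excess E t)
  rw [norm_eq_abs, abs_le]
  constructor <;> linarith

lemma alive_nonneg (t : ℝ) : 0 ≤ M.alive E t :=
  mul_nonneg (M.disc_pos t).le (sub_nonneg.2 (E.stopTime.cdf_le_one t))

lemma alive_le (t : ℝ) : M.alive E t ≤ M.disc t :=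
  mul_le_of_le_one_right (M.disc_pos t).le (by linarith [E.stopTime.cdf_nonneg t])

lemma alive_measurable : Measurable (M.alive E) :=
  M.disc_continuous.measurable.mul (measurable_const.sub E.stopTime.cdf_measurable)

lemma integrableOn_waitA : IntegrableOn (M.waitA E) (Ioi 0) := by
  have hm : Measurable (M.waitA E) := by
    have h1 := M.alive_measurable (E := E)
    have h2 := M.haz_continuous.measurable
    have h3 := E.act_measurable
    unfold waitA
    fun_prop
  refine (M.integrableOn_disc.const_mul (M.haz 0 * M.μ * (1 - M.β) + M.ρ * M.β)).mono'
    hm.aestronglyMeasurable (Eventually.of_forall fun t => ?_)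
  rw [waitA, norm_mul, norm_of_nonneg (M.alive_nonneg t), mul_comm]
  have hβ : 0 < 1 - M.β := by linarith [M.β_lt_μ, M.μ_lt_one]
  have hρ : 0 < M.ρ * M.β := mul_pos M.ρ_pos M.β_pos
  have h0 : 0 ≤ M.haz t * M.μ * (1 - M.β) :=
    mul_nonneg (mul_nonneg (M.haz_nonneg t) M.μ_pos.le) hβ.le
  have h1 : M.haz t * M.μ * (1 - M.β) * E.act t ≤ M.haz 0 * M.μ * (1 - M.β) := by
    refine (mul_le_of_le_one_right h0 (E.act_mem t).2).trans ?_
    exact mul_le_mul_of_nonneg_right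
      (mul_le_mul_of_nonneg_right (M.haz_le_zero t) M.μ_pos.le) hβ.le
  have h2 := mul_nonneg h0 (E.act_mem t).1
  refine mul_le_mul ?_ (M.alive_le t) (M.alive_nonneg t) (by linarith)
  rw [norm_eq_abs, abs_le]
  constructor <;> linarith

lemma waitP_intervalIntegrable {s t : ℝ} (hs : 0 ≤ s) (ht : 0 ≤ t) :
    IntervalIntegrable (M.waitP E) volume s t :=
  intervalIntegrable_iff.2 (M.integrableOn_waitP.mono_set fun _ hx => (le_min hs ht).trans_lt hx.1)

lemma waitA_intervalIntegrable {s t : ℝ} (hs : 0 ≤ s) (ht : 0 ≤ t) :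
    IntervalIntegrable (M.waitA E) volume s t :=
  intervalIntegrable_iff.2 (M.integrableOn_waitA.mono_set fun _ hx => (le_min hs ht).trans_lt hx.1)

/-- The density of type-1 news at `t`, relative to the event that no real news has arrived. -/
lemma news_density_pos (t : ℝ) :
    0 < M.μ * M.haz t * M.noFake E t + M.σ * E.fakeTime.dens t :=
  add_pos_of_pos_of_nonneg (mul_pos (mul_pos M.μ_pos (M.haz_pos t)) (M.noFake_pos E t))
    (mul_nonneg M.σ_pos.le (E.fakeTime.dens_nonneg t))

lemma belief_of_atom {t : ℝ} (h : 0 < E.fakeTime.atom t) : M.belief E.fakeTime t = M.μ := by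
  rw [belief, if_pos h]

lemma belief_of_atom_eq_zero {t : ℝ} (ht : 0 ≤ t) (h : E.fakeTime.atom t = 0) :
    M.belief E.fakeTime t =
      (M.μ * M.haz t * M.noFake E t + M.μ * (M.σ * E.fakeTime.dens t)) /
        (M.μ * M.haz t * M.noFake E t + M.σ * E.fakeTime.dens t) := by
  rw [belief, if_neg (by rw [h]; exact lt_irrefl _),
    div_eq_div_iff _ (M.news_density_pos t).ne', M.g_eq ht, noFake]
  · ring
  · have := mul_pos (M.one_sub_G_pos ht) (M.news_density_pos (E := E) t)
    rw [noFake] at this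
    rw [M.g_eq ht]
    exact (this.trans_eq (by ring)).ne'

lemma news_density_mul_belief_sub {t : ℝ} (ht : 0 ≤ t) (h : E.fakeTime.atom t = 0) :
    (M.μ * M.haz t * M.noFake E t + M.σ * E.fakeTime.dens t) * (M.belief E.fakeTime t - M.θ)
      = M.excess E t := by
  rw [M.belief_of_atom_eq_zero ht h, mul_sub, mul_div_cancel₀ _ (M.news_density_pos t).ne', excess]
  ring

lemma excess_pos_iff {t : ℝ} (ht : 0 ≤ t) (h : E.fakeTime.atom t = 0) :
    0 < M.excess E t ↔ M.θ < M.belief E.fakeTime t := by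
  rw [← M.news_density_mul_belief_sub ht h, mul_pos_iff_of_pos_left (M.news_density_pos t), sub_pos]

lemma belief_of_not_charges {t : ℝ} (ht : 0 ≤ t) (h : ¬ E.fakeTime.Charges t) :
    M.belief E.fakeTime t = 1 := by
  have hd : E.fakeTime.dens t = 0 :=
    le_antisymm (not_lt.1 fun h' => h (Or.inl h')) (E.fakeTime.dens_nonneg t)
  have ha : E.fakeTime.atom t = 0 :=
    le_antisymm (not_lt.1 fun h' => h (Or.inr h')) (E.fakeTime.atom_nonneg t)
  have := (M.news_density_pos (E := E) t).ne'
  rw [M.belief_of_atom_eq_zero ht ha]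
  rw [hd] at this ⊢
  simp only [mul_zero, add_zero] at this ⊢
  exact div_self this

lemma newsP_eq (h1 : ∀ t, 0 ≤ t → M.θ < M.belief E.fakeTime t → E.act t = 1)
    (h0 : ∀ t, 0 ≤ t → M.belief E.fakeTime t < M.θ → E.act t = 0) {t : ℝ} (ht : 0 ≤ t) :
    M.newsP E t = M.θ + max 0 (M.belief E.fakeTime t - M.θ) := by
  rw [newsP]
  rcases lt_trichotomy M.θ (M.belief E.fakeTime t) with h | h | h
  · rw [h1 t ht h, max_eq_right (by linarith)]; ring
  · rw [← h]; simp; ring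
  · rw [h0 t ht h, max_eq_left (by linarith)]; ring

/-- Payoffs of stopping times when the principal responds optimally to news. -/
lemma uP_eq_and_tendsto (h1 : ∀ t, 0 ≤ t → M.θ < M.belief E.fakeTime t → E.act t = 1)
    (h0 : ∀ t, 0 ≤ t → M.belief E.fakeTime t < M.θ → E.act t = 0) :
    (∀ t, 0 ≤ t → M.uP E t = M.θ + ∫ s in (0 : ℝ)..t, M.waitP E s) ∧
      Tendsto (M.uP E) atTop (𝓝 (M.uPInf E)) := by
  obtain ⟨ha, hb⟩ := M.payoff_eq_const_add_integral E.fakeTime (c := M.θ) (e := M.σ)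
    (flow := M.flowP E) (wait := M.waitP E) (lump := M.lumpP E) M.integrableOn_waitP
    (by
      filter_upwards [E.fakeTime.ae_atom_eq_zero] with s hs hs0
      have hmax : (M.μ * M.haz s * M.noFake E s + M.σ * E.fakeTime.dens s)
          * max 0 (M.belief E.fakeTime s - M.θ) = max 0 (M.excess E s) := by
        rw [mul_max_of_nonneg _ _ (M.news_density_pos s).le, mul_zero,
          M.news_density_mul_belief_sub hs0 hs]
      rw [flowP, M.newsP_eq h1 h0 hs0, waitP, ← hmax, M.disc_eq hs0, M.g_eq hs0, noFake]
      ring)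
    (fun s => by
      rw [lumpP]
      rcases (E.fakeTime.atom_nonneg s).eq_or_lt with h | h
      · rw [← h]; simp
      · have hs0 : 0 ≤ s := not_lt.1 fun h' => h.ne' (E.fakeTime.atom_of_neg s h')
        have hB : M.belief E.fakeTime s < M.θ := by rw [M.belief_of_atom h]; exact M.μ_lt_θ
        rw [newsP, h0 s hs0 hB, M.disc_eq hs0]; ring)
  have hlast : ∀ t, 0 ≤ t → exp (-M.ρ * t) * ((1 - M.G t) * (1 - M.σ * E.fakeTime.cdf t)) * M.θ
      = M.θ * (M.disc t * M.noFake E t) := fun t ht => by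
    rw [M.disc_eq ht, noFake]; ring
  refine ⟨fun t ht => by rw [← ha t ht, uP, hlast t ht, noFake], ?_⟩
  have hlim : Tendsto (fun t => M.θ * (M.disc t * M.noFake E t)) atTop (𝓝 0) := by
    refine squeeze_zero (fun t => (mul_pos M.θ_pos (mul_pos (M.disc_pos t)
      (M.noFake_pos E t))).le) (g := fun t => M.θ * M.disc t) (fun t => ?_) ?_
    · exact mul_le_mul_of_nonneg_left (mul_le_of_le_one_right (M.disc_pos t).le
        (M.noFake_le_one E t)) M.θ_pos.le
    · simpa using M.tendsto_disc.const_mul M.θ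
  have := hb.add hlim
  rw [add_zero] at this
  refine this.congr' ?_
  filter_upwards [eventually_ge_atTop 0] with t ht
  rw [uP, hlast t ht]

/-- Payoffs of faking times. -/
lemma uA_eq_and_tendsto :
    (∀ t, 0 ≤ t → M.uA E t = M.β + (∫ s in (0 : ℝ)..t, M.waitA E s)
      + M.alive E t * E.act t * (M.μ - M.β)) ∧
      Tendsto (M.uA E) atTop (𝓝 (M.uAInf E)) := by
  obtain ⟨ha, hb⟩ := M.payoff_eq_const_add_integral E.stopTime (c := M.β) (e := 1)
    (flow := M.flowA E) (wait := M.waitA E) (lump := M.lumpA E) M.integrableOn_waitA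
    (Eventually.of_forall fun s hs0 => by
      rw [flowA, waitA, alive, M.disc_eq hs0, M.g_eq hs0]
      ring)
    (fun s => by
      rw [lumpA]
      rcases (E.stopTime.atom_nonneg s).eq_or_lt with h | h
      · rw [← h]; simp
      · have hs0 : 0 ≤ s := not_lt.1 fun h' => h.ne' (E.stopTime.atom_of_neg s h')
        rw [M.disc_eq hs0]; ring)
  have hlast : ∀ t, 0 ≤ t → exp (-M.ρ * t) * ((1 - M.G t) * (1 - E.stopTime.cdf t))
      * ((1 - E.act t) * M.β + M.μ * E.act t)
      = M.alive E t * ((1 - E.act t) * M.β + M.μ * E.act t) := fun t ht => by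
    rw [alive, M.disc_eq ht]; ring
  refine ⟨fun t ht => by rw [← ha t ht, uA, hlast t ht, alive]; ring, ?_⟩
  have hlim : Tendsto (fun t => M.alive E t * ((1 - E.act t) * M.β + M.μ * E.act t)) atTop
      (𝓝 0) := by
    have hnn : ∀ t, 0 ≤ (1 - E.act t) * M.β + M.μ * E.act t := fun t =>
      add_nonneg (mul_nonneg (sub_nonneg.2 (E.act_mem t).2) M.β_pos.le)
        (mul_nonneg M.μ_pos.le (E.act_mem t).1)
    refine squeeze_zero (fun t => mul_nonneg (M.alive_nonneg t) (hnn t)) (fun t => ?_)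
      M.tendsto_disc
    have hle : (1 - E.act t) * M.β + M.μ * E.act t ≤ 1 := by
      have h1 := E.act_mem t
      nlinarith [h1.1, h1.2, M.β_lt_μ, M.μ_lt_one]
    exact (mul_le_of_le_one_right (M.alive_nonneg t) hle).trans (M.alive_le t)
  have := hb.add hlim
  rw [add_zero] at this
  refine this.congr' ?_
  filter_upwards [eventually_ge_atTop 0] with t ht
  rw [uA, hlast t ht]

end SearchModel

/-! ### Monotonicity, linear integral equations and primitives -/

/-- A function that decreases strictly wherever it vanishes stays negative once it is nonpositive. -/
lemma neg_of_hasDerivAt_neg_at_zeros {f f' : ℝ → ℝ} {a b : ℝ} (hf : ∀ x, HasDerivAt f (f' x) x)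
    (ha : f a ≤ 0) (h : ∀ x ∈ Ico a b, f x = 0 → f' x < 0) : ∀ x ∈ Ioo a b, f x < 0 := by
  have hc : Continuous f := continuous_iff_continuousAt.2 fun x => (hf x).continuousAt
  have hle : ∀ x ∈ Ico a b, f x ≤ 0 := fun x hx =>
    image_le_of_deriv_right_lt_deriv_boundary (B := fun _ => 0) (B' := fun _ => 0)
      hc.continuousOn (fun y _ => (hf y).hasDerivWithinAt) ha (fun y => hasDerivAt_const y 0)
      (fun y hy h0 => h y ⟨hy.1, hy.2.trans_le hx.2.le⟩ h0) (right_mem_Icc.2 hx.1)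
  intro x hx
  refine lt_of_le_of_ne (hle x ⟨hx.1.le, hx.2⟩) fun h0 => ?_
  have hmax : IsLocalMax f x := by
    filter_upwards [Ioo_mem_nhds hx.1 hx.2] with y hy
    rw [h0]; exact hle y ⟨hy.1.le, hy.2⟩
  exact (h x ⟨hx.1.le, hx.2⟩ h0).ne (hmax.hasDerivAt_eq_zero (hf x))

/-- The solution of a linear integral equation is an exponential. -/
lemma eq_mul_exp_of_integral_eq {f q : ℝ → ℝ} {a b : ℝ} (hab : a ≤ b)
    (hf : ContinuousOn f (Icc a b)) (hq : Continuous q)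
    (h : ∀ t ∈ Icc a b, f t = f a + ∫ s in a..t, q s * f s) :
    ∀ t ∈ Icc a b, f t = f a * exp (∫ s in a..t, q s) := by
  let f₁ : ℝ → ℝ := IccExtend hab ((Icc a b).domRestrict f)
  have hf₁ : Continuous f₁ := hf.domRestrict.Icc_extend'
  have hf₁_eq : ∀ t ∈ Icc a b, f₁ t = f t := fun t ht => IccExtend_of_mem hab _ ht
  let F : ℝ → ℝ := fun t => f a + ∫ s in a..t, q s * f₁ s
  have hF : ∀ t, HasDerivAt F (q t * f₁ t) t := fun t =>
    ((hq.mul hf₁).integral_hasStrictDerivAt a t).hasDerivAt.const_add (f a)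
  have hF_eq : ∀ t ∈ Icc a b, F t = f t := fun t ht => by
    rw [h t ht]
    simp only [F]
    congr 1
    refine intervalIntegral.integral_congr fun s hs => ?_
    rw [uIcc_of_le ht.1] at hs
    simp only [hf₁_eq s ⟨hs.1, hs.2.trans ht.2⟩]
  have hE : ∀ t, HasDerivAt (fun t => exp (-∫ s in a..t, q s))
      (exp (-∫ s in a..t, q s) * -q t) t := fun t =>
    (hq.integral_hasStrictDerivAt a t).hasDerivAt.fun_neg.exp
  have hconst := constant_of_has_deriv_right_zero (a := a) (b := b)
    (f := fun t => F t * exp (-∫ s in a..t, q s))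
    (fun t _ => ((hF t).mul (hE t)).continuousAt.continuousWithinAt) (fun t ht => by
      refine ((hF t).mul (hE t)).hasDerivWithinAt.congr_deriv ?_
      rw [hF_eq t (Ico_subset_Icc_self ht), hf₁_eq t (Ico_subset_Icc_self ht)]
      ring)
  intro t ht
  have h1 := hconst t ht
  simp only [hF_eq t ht, hF_eq a (left_mem_Icc.2 hab), intervalIntegral.integral_same, neg_zero,
    exp_zero, mul_one] at h1
  rw [← h1, mul_assoc, ← exp_add, neg_add_cancel, exp_zero, mul_one]

lemma continuousOn_Ici_primitive {f : ℝ → ℝ} (hf : IntegrableOn f (Ioi 0)) :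
    ContinuousOn (fun t => ∫ s in (0 : ℝ)..t, f s) (Ici 0) := by
  have h1 : Integrable ((Ioi 0).indicator f) := (integrable_indicator_iff measurableSet_Ioi).2 hf
  refine (intervalIntegral.continuous_primitive (fun a b => h1.intervalIntegrable) 0
    ).continuousOn.congr fun t ht => ?_
  refine intervalIntegral.integral_congr_ae (Eventually.of_forall fun s hs => ?_)
  rw [uIoc_of_le ht] at hs
  exact (indicator_of_mem (show s ∈ Ioi (0 : ℝ) from hs.1) f).symm

namespace SearchModel

/-! ### Structure of a beneficial equilibrium -/

/-- An equilibrium `E` in which the highest payoffs that the principal and the agent can obtain from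
a stopping time, respectively from a faking time, are `V > θ` and `W`; the hazard rate of real news
is such that the principal gains from waiting for real news until `τP` and the agent gains from
waiting at all times up to `τP`. -/
structure BeneficialValues (M : SearchModel) (E : Profile) (τP V W : ℝ) : Prop where
  pos : 0 < τP
  gainP_eq : M.gainP τP = 0
  gainA_pos : ∀ t ≤ τP, 0 < M.gainA t
  lt : M.θ < V
  act_one : ∀ t, 0 ≤ t → M.θ < M.belief E.fakeTime t → E.act t = 1
  act_zero : ∀ t, 0 ≤ t → M.belief E.fakeTime t < M.θ → E.act t = 0
  uP_le : ∀ t, 0 ≤ t → M.uP E t ≤ V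
  uP_eq : ∀ t, E.stopTime.Charges t → M.uP E t = V
  uPInf_eq : 0 < E.stopTime.never → M.uPInf E = V
  payoffP_eq : M.payoffP E = V
  uA_le : ∀ t, 0 ≤ t → M.uA E t ≤ W
  uA_eq : ∀ t, E.fakeTime.Charges t → M.uA E t = W
  uAInf_eq : 0 < E.fakeTime.never → M.uAInf E = W
  payoffA_eq : M.payoffA E = W

lemma gainA_pos_of_le {M : SearchModel} (hA2 : M.A2) {τP t : ℝ}
    (hτP : M.gainP τP = 0) (ht : t ≤ τP) : 0 < M.gainA t := by
  have h1 : M.phiP ≤ M.haz t := by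
    refine le_trans (not_lt.1 fun h => ?_) (M.haz_antitone ht)
    rw [gainP] at hτP
    have hμ : 0 < M.μ * (1 - M.θ) := mul_pos M.μ_pos (sub_pos.2 M.θ_lt_one)
    rw [phiP, lt_div_iff₀ hμ] at h
    linarith
  rw [gainA]
  exact M.phiA_lt_iff.1 (lt_of_lt_of_le hA2 h1)

lemma IsBeneficialEquilibrium.exists_values {M : SearchModel} (hA1 : M.A1) (hA2 : M.A2) {τP : ℝ}
    (hτP : M.IsFirstBestDurationP τP) {E : Profile} (hE : M.IsBeneficialEquilibrium E) :
    ∃ V W, M.BeneficialValues E τP V W := by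
  obtain ⟨h0, hg⟩ := M.gainP_firstBestDuration hA1 hτP
  obtain ⟨⟨hf, h1, h2, hs⟩, hb⟩ := hE
  obtain ⟨V, v1, v2, v3, v4⟩ := hs.exists_value
  obtain ⟨W, w1, w2, w3, w4⟩ := hf.exists_value
  refine ⟨V, W, h0, hg, fun t ht => gainA_pos_of_le hA2 hg ht, ?_, h1, h2, v1, v2, v3, v4, w1,
    w2, w3, w4⟩
  rw [← v4]; exact hb

namespace BeneficialValues

variable {M : SearchModel} {E : Profile} {τP V W : ℝ} (H : M.BeneficialValues E τP V W)

include H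

lemma uP_formula {t : ℝ} (ht : 0 ≤ t) : M.uP E t = M.θ + ∫ s in (0 : ℝ)..t, M.waitP E s :=
  (M.uP_eq_and_tendsto H.act_one H.act_zero).1 t ht

lemma uP_sub {s t : ℝ} (hs : 0 ≤ s) (ht : 0 ≤ t) :
    M.uP E t - M.uP E s = ∫ x in s..t, M.waitP E x := by
  rw [H.uP_formula hs, H.uP_formula ht, ← intervalIntegral.integral_interval_sub_left
    (M.waitP_intervalIntegrable le_rfl ht) (M.waitP_intervalIntegrable le_rfl hs)]
  ring

lemma uP_continuousOn : ContinuousOn (M.uP E) (Ici 0) :=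
  (continuousOn_const.add (continuousOn_Ici_primitive M.integrableOn_waitP)).congr
    fun _ ht => H.uP_formula ht

lemma gainP_pos {t : ℝ} (h0 : 0 ≤ t) (ht : t < τP) : 0 < M.gainP t :=
  H.gainP_eq ▸ M.gainP_lt h0 ht

lemma gainP_neg {t : ℝ} (ht : τP < t) : M.gainP t < 0 :=
  H.gainP_eq ▸ M.gainP_lt H.pos.le ht

lemma uP_zero : M.uP E 0 = M.θ := by rw [H.uP_formula le_rfl]; simp

omit H in
lemma waitP_of_not_charges {t : ℝ} (h : ¬ E.fakeTime.Charges t) :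
    M.waitP E t = M.disc t * (M.gainP t * M.noFake E t) := by
  have hd : E.fakeTime.dens t = 0 :=
    le_antisymm (not_lt.1 fun h' => h (Or.inl h')) (E.fakeTime.dens_nonneg t)
  have := M.news_coeff_pos (E := E) t
  rw [waitP, excess, hd, mul_zero, mul_zero, sub_zero, max_eq_right this.le, gainP]
  ring

/-- As long as the agent does not fake before `τP`, the principal gains from waiting. -/
lemma uP_lt_of_not_charges {s t : ℝ} (hs : 0 ≤ s) (hst : s < t) (ht : t ≤ τP)
    (h : ∀ x ∈ Ioo s t, ¬ E.fakeTime.Charges x) : M.uP E s < M.uP E t := by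
  rw [← sub_pos, H.uP_sub hs (hs.trans hst.le)]
  refine intervalIntegral.intervalIntegral_pos_of_pos_on
    (M.waitP_intervalIntegrable hs (hs.trans hst.le)) (fun x hx => ?_) hst
  rw [waitP_of_not_charges (h x hx)]
  exact mul_pos (M.disc_pos x)
    (mul_pos (H.gainP_pos (hs.trans hx.1.le) (hx.2.trans_le ht)) (M.noFake_pos E x))

lemma uP_lt_of_ge {s t : ℝ} (hs : τP ≤ s) (hst : s < t) : M.uP E t < M.uP E s := by
  have hs0 : 0 ≤ s := H.pos.le.trans hs
  rw [← sub_neg, H.uP_sub hs0 (hs0.trans hst.le)]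
  have : 0 < ∫ x in s..t, -M.waitP E x := by
    refine intervalIntegral.intervalIntegral_pos_of_pos_on
      (M.waitP_intervalIntegrable hs0 (hs0.trans hst.le)).neg (fun x hx => ?_) hst
    have h1 := M.waitP_le (E := E) x
    have h2 := mul_neg_of_pos_of_neg (M.disc_pos x)
      (mul_neg_of_neg_of_pos (H.gainP_neg (hs.trans_lt hx.1)) (M.noFake_pos E x))
    linarith
  rw [intervalIntegral.integral_neg] at this
  linarith

lemma not_stop_of_gt {t : ℝ} (ht : τP < t) : ¬ E.stopTime.Charges t := fun h => by
  have h1 := H.uP_eq t h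
  have h2 := H.uP_lt_of_ge le_rfl ht
  have h3 := H.uP_le τP H.pos.le
  linarith

lemma stop_never : E.stopTime.never = 0 := by
  by_contra hne
  have h1 := H.uPInf_eq (lt_of_le_of_ne E.stopTime.never_nonneg (Ne.symm hne))
  have h2 : M.uPInf E ≤ M.uP E (τP + 1) := by
    refine le_of_tendsto (M.uP_eq_and_tendsto H.act_one H.act_zero).2 ?_
    filter_upwards [eventually_gt_atTop (τP + 1)] with t ht
    exact (H.uP_lt_of_ge (by linarith) ht).le
  have h3 := H.uP_lt_of_ge le_rfl (lt_add_one τP)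
  have h4 := H.uP_le τP H.pos.le
  linarith

lemma stop_cdf_of_ge {t : ℝ} (ht : τP ≤ t) : E.stopTime.cdf t = 1 := by
  refine le_antisymm (E.stopTime.cdf_le_one t) ?_
  have h1 := E.stopTime.law_real_univ
  have h2 : E.stopTime.law.real (Ioi t) = 0 :=
    E.stopTime.law_eq_zero measurableSet_Ioi fun x hx => H.not_stop_of_gt (lt_of_le_of_lt ht hx)
  rw [H.stop_never, ← Iic_union_Ioi (a := t),
    measureReal_union (Iic_disjoint_Ioi le_rfl) measurableSet_Ioi, h2, ← E.stopTime.cdf_eq] at h1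
  linarith

end BeneficialValues

/-- What is left of the highest payoff `W` of the agent after `β` and his gains from waiting until
`t` have been subtracted. A fake at `t` attains `W` if and only if its premium over `β` is equal to
the slack. -/
def slack (M : SearchModel) (E : Profile) (W t : ℝ) : ℝ := W - M.β - ∫ s in (0 : ℝ)..t, M.waitA E s

namespace BeneficialValues

variable {M : SearchModel} {E : Profile} {τP V W : ℝ} (H : M.BeneficialValues E τP V W)

lemma slack_sub {s t : ℝ} (hs : 0 ≤ s) (ht : 0 ≤ t) :
    M.slack E W t = M.slack E W s - ∫ x in s..t, M.waitA E x := by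
  rw [slack, slack, ← intervalIntegral.integral_interval_sub_left
    (M.waitA_intervalIntegrable le_rfl ht) (M.waitA_intervalIntegrable le_rfl hs)]
  ring

lemma slack_continuousOn : ContinuousOn (M.slack E W) (Ici 0) :=
  continuousOn_const.sub (continuousOn_Ici_primitive M.integrableOn_waitA)

lemma μ_sub_β_pos : 0 < M.μ - M.β := sub_pos.2 M.β_lt_μ

include H

lemma premium_le_slack {t : ℝ} (ht : 0 ≤ t) :
    M.alive E t * E.act t * (M.μ - M.β) ≤ M.slack E W t := by
  have h := H.uA_le t ht
  rw [M.uA_eq_and_tendsto.1 t ht] at h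
  rw [slack]; linarith

lemma premium_eq_slack {t : ℝ} (h : E.fakeTime.Charges t) :
    M.alive E t * E.act t * (M.μ - M.β) = M.slack E W t := by
  have ht : 0 ≤ t := not_lt.1 fun h' => E.fakeTime.not_charges_of_neg h' h
  have h := H.uA_eq t h
  rw [M.uA_eq_and_tendsto.1 t ht] at h
  rw [slack]; linarith

lemma act_of_not_charges {t : ℝ} (ht : 0 ≤ t) (h : ¬ E.fakeTime.Charges t) : E.act t = 1 :=
  H.act_one t ht (by rw [M.belief_of_not_charges ht h]; exact M.θ_lt_one)

lemma slack_nonneg {t : ℝ} (ht : 0 ≤ t) : 0 ≤ M.slack E W t :=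
  (mul_nonneg (mul_nonneg (M.alive_nonneg t) (E.act_mem t).1) μ_sub_β_pos.le).trans
    (H.premium_le_slack ht)

/-- The principal's response to news is a function of the slack of the agent: where it is too small
for the agent to abstain from a fake that is trusted, it leaves him indifferent. -/
lemma premium_eq_min {t : ℝ} (ht : 0 ≤ t) :
    M.alive E t * E.act t * (M.μ - M.β) = min (M.alive E t * (M.μ - M.β)) (M.slack E W t) := by
  have h1 : M.alive E t * E.act t * (M.μ - M.β) ≤ M.alive E t * (M.μ - M.β) :=
    mul_le_mul_of_nonneg_right (mul_le_of_le_one_right (M.alive_nonneg t) (E.act_mem t).2)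
      μ_sub_β_pos.le
  have h2 := H.premium_le_slack ht
  by_cases h : E.fakeTime.Charges t
  · have h3 := H.premium_eq_slack h
    rw [h3] at h1 ⊢
    rw [min_eq_right h1]
  · rw [H.act_of_not_charges ht h, mul_one] at h2 ⊢
    rw [min_eq_left h2]

lemma waitA_eq {t : ℝ} (ht : 0 ≤ t) :
    M.waitA E t = M.haz t * M.μ * (1 - M.β) / (M.μ - M.β)
      * min (M.alive E t * (M.μ - M.β)) (M.slack E W t) - M.ρ * M.β * M.alive E t := by
  have := (μ_sub_β_pos (M := M)).ne'
  rw [← H.premium_eq_min ht, waitA]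
  field_simp

/-- If the principal has stopped for sure at `T`, and not before, faking at `T` is not optimal:
otherwise the slack would vanish at `T`, hence so would the premium of fakes shortly before `T`, and
the agent would lose from waiting at that time. -/
lemma uA_lt_of_stopped {T : ℝ} (hT : 0 < T) (h1 : E.stopTime.cdf T = 1)
    (hlt : ∀ t < T, E.stopTime.cdf t < 1) : M.uA E T < W := by
  refine lt_of_le_of_ne (H.uA_le T hT.le) fun hW => ?_
  have hYT : M.slack E W T = 0 := by
    rw [M.uA_eq_and_tendsto.1 T hT.le, alive, h1] at hW
    rw [slack]; linarith
  set C := M.haz 0 * M.μ * (1 - M.β) / (M.μ - M.β) with hC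
  have hβ : 0 < 1 - M.β := by linarith [M.β_lt_μ, M.μ_lt_one]
  have hCpos : 0 < C :=
    div_pos (mul_pos (mul_pos (M.haz_pos 0) M.μ_pos) hβ) μ_sub_β_pos
  obtain ⟨a, ha0, haT, haC⟩ : ∃ a, 0 ≤ a ∧ a < T ∧ (T - a) * C < 1 := by
    have h2 : 0 < 1 / (C + 1) := by positivity
    refine ⟨max 0 (T - 1 / (C + 1)), le_max_left _ _, max_lt hT (by linarith), ?_⟩
    have h3 : T - max 0 (T - 1 / (C + 1)) ≤ 1 / (C + 1) := by
      linarith [le_max_right 0 (T - 1 / (C + 1))]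
    calc _ ≤ 1 / (C + 1) * C := mul_le_mul_of_nonneg_right h3 hCpos.le
      _ < 1 := by rw [one_div_mul_eq_div, div_lt_one (by linarith)]; linarith
  obtain ⟨m, hm, hmax⟩ := isCompact_Icc.exists_isMaxOn (nonempty_Icc.2 haT.le)
    (slack_continuousOn (M := M) (E := E) (W := W) |>.mono
      (fun x hx => ha0.trans hx.1 : Icc a T ⊆ Ici 0))
  -- the maximum of the slack is attained before `T`, because the slack is zero at `T`
  obtain ⟨b, hb, hbT, hbmax⟩ : ∃ b ∈ Icc a T, b < T ∧
      ∀ x ∈ Icc a T, M.slack E W x ≤ M.slack E W b := by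
    rcases hm.2.lt_or_eq with h | h
    · exact ⟨m, hm, h, fun x hx => hmax hx⟩
    · refine ⟨a, left_mem_Icc.2 haT.le, haT, fun x hx => ?_⟩
      have h2 : M.slack E W x ≤ M.slack E W m := hmax hx
      rw [h, hYT] at h2
      exact h2.trans (H.slack_nonneg ha0)
  have hb0 : 0 ≤ b := ha0.trans hb.1
  set S := M.slack E W b
  have hS : 0 ≤ S := H.slack_nonneg hb0
  have hint : 0 < ∫ x in b..T, (C * S - M.waitA E x) := by
    refine intervalIntegral.intervalIntegral_pos_of_pos_on
      ((continuous_const.intervalIntegrable _ _).sub (M.waitA_intervalIntegrable hb0 hT.le))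
      (fun x hx => ?_) hbT
    have hx0 : 0 ≤ x := hb0.trans hx.1.le
    have hR : 0 < M.alive E x := mul_pos (M.disc_pos x) (sub_pos.2 (hlt x hx.2))
    have h4 : M.haz x * M.μ * (1 - M.β) / (M.μ - M.β) ≤ C :=
      div_le_div_of_nonneg_right (mul_le_mul_of_nonneg_right
        (mul_le_mul_of_nonneg_right (M.haz_le_zero x) M.μ_pos.le) hβ.le) μ_sub_β_pos.le
    have h5 : min (M.alive E x * (M.μ - M.β)) (M.slack E W x) ≤ S :=
      (min_le_right _ _).trans (hbmax x ⟨hb.1.trans hx.1.le, hx.2.le⟩)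
    have h6 : 0 ≤ min (M.alive E x * (M.μ - M.β)) (M.slack E W x) :=
      le_min (mul_nonneg hR.le μ_sub_β_pos.le) (H.slack_nonneg hx0)
    have h7 := mul_le_mul h4 h5 h6 hCpos.le
    have h8 := mul_pos (mul_pos M.ρ_pos M.β_pos) hR
    rw [H.waitA_eq hx0]
    linarith
  rw [intervalIntegral.integral_sub (continuous_const.intervalIntegrable _ _)
    (M.waitA_intervalIntegrable hb0 hT.le), intervalIntegral.integral_const, smul_eq_mul] at hint
  have h9 := slack_sub (M := M) (E := E) (W := W) hb0 hT.le
  rw [hYT] at h9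
  have h10 : (T - b) * (C * S) ≤ S := by
    have h11 : (T - b) * C ≤ 1 := by
      have := mul_le_mul_of_nonneg_right (by linarith [hb.1] : T - b ≤ T - a) hCpos.le
      linarith
    calc (T - b) * (C * S) = (T - b) * C * S := by ring
      _ ≤ 1 * S := mul_le_mul_of_nonneg_right h11 hS
      _ = S := one_mul S
  linarith

/-- A point to the left of which the principal stops with positive probability in every
neighbourhood is an optimal stopping time. -/
lemma uP_eq_of_cdf_lt {T : ℝ} (hT : 0 ≤ T) (h : ∀ t < T, E.stopTime.cdf t < E.stopTime.cdf T) :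
    M.uP E T = V := by
  refine le_antisymm (H.uP_le T hT) (not_lt.1 fun hlt => ?_)
  obtain ⟨a, haT, ha⟩ : ∃ a < T, ∀ x ∈ Ioc a T, 0 ≤ x → M.uP E x < V := by
    have h1 := (H.uP_continuousOn T hT).eventually_lt_const hlt
    rw [eventually_nhdsWithin_iff] at h1
    obtain ⟨l, hl, u, hu, hlu⟩ : ∃ l < T, ∃ u > T, ∀ x ∈ Ioo l u, 0 ≤ x → M.uP E x < V := by
      obtain ⟨l, u, hlu, hsub⟩ := mem_nhds_iff_exists_Ioo_subset.1 h1
      exact ⟨l, hlu.1, u, hlu.2, fun x hx => hsub hx⟩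
    exact ⟨l, hl, fun x hx => hlu x ⟨hx.1, hx.2.trans_lt hu⟩⟩
  have h2 : E.stopTime.law.real (Ioc a T) = 0 :=
    E.stopTime.law_eq_zero measurableSet_Ioc fun x hx hc =>
      (ha x hx (not_lt.1 fun h' => E.stopTime.not_charges_of_neg h' hc)).ne (H.uP_eq x hc)
  rw [← E.stopTime.cdf_sub a T haT.le] at h2
  linarith [h a haT]

/-- The principal stops with certainty at `τP` and not before, and stopping at `τP` is optimal. -/
lemma stop_at_τP : (∀ t < τP, E.stopTime.cdf t < 1) ∧ M.uP E τP = V := by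
  let A : Set ℝ := {t | 0 ≤ t ∧ E.stopTime.cdf t = 1}
  have hA : τP ∈ A := ⟨H.pos.le, H.stop_cdf_of_ge le_rfl⟩
  have hbdd : BddBelow A := ⟨0, fun t ht => ht.1⟩
  set T := sInf A with hTdef
  have hT0 : 0 ≤ T := le_csInf ⟨τP, hA⟩ fun t ht => ht.1
  have hTle : T ≤ τP := csInf_le hbdd hA
  have hT1 : E.stopTime.cdf T = 1 := by
    refine le_antisymm (E.stopTime.cdf_le_one T) (ge_of_tendsto (E.stopTime.cdf_rightCts T) ?_)
    filter_upwards [self_mem_nhdsWithin] with r hr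
    obtain ⟨a, ha, har⟩ := exists_lt_of_csInf_lt ⟨τP, hA⟩ (show sInf A < r from hr)
    exact ha.2 ▸ E.stopTime.cdf_mono har.le
  have hlt : ∀ t < T, E.stopTime.cdf t < 1 := fun t ht => by
    refine lt_of_le_of_ne (E.stopTime.cdf_le_one t) fun h => ?_
    rcases lt_or_ge t 0 with h0 | h0
    · rw [E.stopTime.cdf_of_neg h0] at h; exact zero_ne_one h
    · exact notMem_of_lt_csInf ht hbdd ⟨h0, h⟩
  have hV : M.uP E T = V := H.uP_eq_of_cdf_lt hT0 fun t ht => by rw [hT1]; exact hlt t ht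
  have hTpos : 0 < T := by
    refine lt_of_le_of_ne hT0 fun h => ?_
    rw [← h, H.uP_zero] at hV
    exact H.lt.ne hV
  have hTeq : T = τP := by
    refine le_antisymm hTle (not_lt.1 fun hTlt => ?_)
    obtain ⟨x, hx, hxc⟩ : ∃ x ∈ Ioo T τP, E.fakeTime.Charges x := by
      by_contra! hno
      have h1 := H.uP_lt_of_not_charges hT0 hTlt le_rfl hno
      linarith [H.uP_le τP H.pos.le]
    have hdead : ∀ y ∈ Ici T, M.alive E y = 0 := fun y hy => by
      have h2 : E.stopTime.cdf y = 1 :=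
        le_antisymm (E.stopTime.cdf_le_one y) (hT1 ▸ E.stopTime.cdf_mono hy)
      rw [alive, h2, sub_self, mul_zero]
    have hx0 : 0 ≤ x := hT0.trans hx.1.le
    have h3 := H.uA_eq x hxc
    have h4 : ∫ s in T..x, M.waitA E s = 0 := by
      refine (intervalIntegral.integral_congr (g := fun _ => 0) fun s hs => ?_).trans (by simp)
      rw [uIcc_of_le hx.1.le] at hs
      simp only [waitA, hdead s hs.1, zero_mul]
    have h5 := slack_sub (M := M) (E := E) (W := W) hT0 hx0
    rw [h4, sub_zero, slack, slack] at h5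
    have h6 := H.uA_lt_of_stopped hTpos hT1 hlt
    rw [M.uA_eq_and_tendsto.1 x hx0, hdead x hx.1.le] at h3
    rw [M.uA_eq_and_tendsto.1 T hT0, hdead T (mem_Ici.2 le_rfl)] at h6
    linarith
  rw [hTeq] at hlt hV
  exact ⟨hlt, hV⟩

lemma alive_pos {t : ℝ} (ht : t < τP) : 0 < M.alive E t :=
  mul_pos (M.disc_pos t) (sub_pos.2 (H.stop_at_τP.1 t ht))

lemma alive_eq_zero {t : ℝ} (ht : τP ≤ t) : M.alive E t = 0 := by
  rw [alive, H.stop_cdf_of_ge ht, sub_self, mul_zero]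

lemma uA_of_ge {t : ℝ} (ht : τP ≤ t) : M.uA E t = M.uA E τP := by
  have h0 := H.pos.le.trans ht
  have h4 : ∫ s in τP..t, M.waitA E s = 0 := by
    refine (intervalIntegral.integral_congr (g := fun _ => 0) fun s hs => ?_).trans (by simp)
    rw [uIcc_of_le ht] at hs
    simp only [waitA, H.alive_eq_zero hs.1, zero_mul]
  have h5 := slack_sub (M := M) (E := E) (W := W) H.pos.le h0
  rw [h4, sub_zero, slack, slack] at h5
  rw [M.uA_eq_and_tendsto.1 t h0, M.uA_eq_and_tendsto.1 τP H.pos.le, H.alive_eq_zero ht,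
    H.alive_eq_zero le_rfl]
  linarith

lemma uA_τP_lt : M.uA E τP < W :=
  H.uA_lt_of_stopped H.pos (H.stop_cdf_of_ge le_rfl) H.stop_at_τP.1

lemma not_fake_of_ge {t : ℝ} (ht : τP ≤ t) : ¬ E.fakeTime.Charges t := fun h => by
  have h1 := H.uA_eq t h
  rw [H.uA_of_ge ht] at h1
  exact H.uA_τP_lt.ne h1

lemma fake_never : E.fakeTime.never = 0 := by
  by_contra hne
  have h1 := H.uAInf_eq (lt_of_le_of_ne E.fakeTime.never_nonneg (Ne.symm hne))
  have h2 : M.uAInf E ≤ M.uA E τP := by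
    refine le_of_tendsto M.uA_eq_and_tendsto.2 ?_
    filter_upwards [eventually_ge_atTop τP] with t ht using (H.uA_of_ge ht).le
  linarith [H.uA_τP_lt]

end BeneficialValues

end SearchModel

/-! ### Faking times, the soft deadline and the distributions -/

namespace SearchModel

namespace BeneficialValues

variable {M : SearchModel} {E : Profile} {τP V W : ℝ} (H : M.BeneficialValues E τP V W)

include H

/-- The agent fakes only at times that are optimal stopping times. Otherwise no stopping occurs from
the time of the fake until the next optimal stopping time; to remain willing to fake, the agent must
be compensated by falling trust in news, so that news is worth no more than `θ` to the principal and
her payoff decreases up to that stopping time. -/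
lemma uP_eq_of_fake {t : ℝ} (ht : E.fakeTime.Charges t) : M.uP E t = V := by
  have ht0 : 0 ≤ t := not_lt.1 fun h' => E.fakeTime.not_charges_of_neg h' ht
  have htP : t < τP := not_le.1 fun h => H.not_fake_of_ge h ht
  refine le_antisymm (H.uP_le t ht0) (not_lt.1 fun hlt => ?_)
  -- the next optimal stopping time
  let A : Set ℝ := {s ∈ Icc t τP | M.uP E s = V}
  have hAclosed : IsClosed A := by
    have hc : ContinuousOn (M.uP E) (Icc t τP) :=
      H.uP_continuousOn.mono fun s hs => ht0.trans hs.1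
    exact hc.preimage_isClosed_of_isClosed isClosed_Icc isClosed_singleton
  have hAne : A.Nonempty := ⟨τP, right_mem_Icc.2 htP.le, H.stop_at_τP.2⟩
  have hAbdd : BddBelow A := ⟨t, fun s hs => hs.1.1⟩
  obtain ⟨⟨htd, hdP⟩, hdV⟩ : sInf A ∈ A := hAclosed.csInf_mem hAne hAbdd
  set d := sInf A with hd
  have htd' : t < d := lt_of_le_of_ne htd fun h => by rw [← h] at hdV; exact hlt.ne hdV
  have hbefore : ∀ s ∈ Ico t d, M.uP E s ≠ V := fun s hs h =>
    notMem_of_lt_csInf hs.2 hAbdd ⟨⟨hs.1, hs.2.le.trans hdP⟩, h⟩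
  -- no stopping occurs on `(t, d)`
  set c := E.stopTime.cdf t with hc
  have hcdf : ∀ x ∈ Ico t d, E.stopTime.cdf x = c := fun x hx => by
    have h1 : E.stopTime.law.real (Ioc t x) = 0 :=
      E.stopTime.law_eq_zero measurableSet_Ioc fun y hy hyc =>
        hbefore y ⟨hy.1.le, hy.2.trans_lt hx.2⟩ (H.uP_eq y hyc)
    rw [← E.stopTime.cdf_sub t x hx.1] at h1
    linarith
  have hc1 : 0 < 1 - c := sub_pos.2 (H.stop_at_τP.1 t htP)
  let R : ℝ → ℝ := fun x => M.disc x * (1 - c)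
  have hR : ∀ x ∈ Ico t d, M.alive E x = R x := fun x hx => by rw [alive, hcdf x hx]
  have hRpos : ∀ x, 0 < R x := fun x => mul_pos (M.disc_pos x) hc1
  have hμβ := μ_sub_β_pos (M := M)
  -- on `[t, d)` the slack solves a differential equation with continuous right-hand side
  let Y : ℝ → ℝ := fun x => M.slack E W (max x 0)
  have hYc : Continuous Y :=
    slack_continuousOn.comp_continuous (continuous_id.max continuous_const) fun x =>
      le_max_right x 0
  have hdc := M.disc_continuous
  have hhc := M.haz_continuous
  let φ : ℝ → ℝ := fun x => M.haz x * M.μ * (1 - M.β) / (M.μ - M.β)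
      * min (R x * (M.μ - M.β)) (Y x) - M.ρ * M.β * R x
  have hφc : Continuous φ := by
    simp only [φ, R]
    fun_prop
  let Z : ℝ → ℝ := fun x => (M.slack E W t - ∫ s in t..x, φ s) - R x * (M.μ - M.β)
  have hZ : ∀ x ∈ Ico t d, Z x = M.slack E W x - M.alive E x * (M.μ - M.β) := fun x hx => by
    have hx0 : 0 ≤ x := ht0.trans hx.1
    have h1 : ∫ s in t..x, φ s = ∫ s in t..x, M.waitA E s := by
      refine intervalIntegral.integral_congr fun s hs => ?_
      rw [uIcc_of_le hx.1] at hs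
      have hs0 : 0 ≤ s := ht0.trans hs.1
      simp only [φ, Y]
      rw [H.waitA_eq hs0, hR s ⟨hs.1, hs.2.trans_lt hx.2⟩, max_eq_left hs0]
    simp only [Z]
    rw [h1, ← slack_sub ht0 hx0, hR x hx]
  have hZd : ∀ x, HasDerivAt Z
      (-φ x - (-((M.ρ + M.haz x) * M.disc x) * (1 - c)) * (M.μ - M.β)) x := fun x =>
    ((hφc.integral_hasStrictDerivAt t x).hasDerivAt.const_sub _).sub
      (((M.hasDerivAt_disc x).mul_const _).mul_const _)
  have hZneg := neg_of_hasDerivAt_neg_at_zeros (a := t) (b := d) hZd (by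
      rw [hZ t ⟨le_rfl, htd'⟩, ← H.premium_eq_slack ht]
      have := mul_le_mul_of_nonneg_right
        (mul_le_of_le_one_right (M.alive_nonneg (E := E) t) (E.act_mem t).2) hμβ.le
      linarith) (fun x hx h0 => by
      have hx0 : 0 ≤ x := ht0.trans hx.1
      have hY : Y x = R x * (M.μ - M.β) := by
        rw [hZ x hx, hR x hx] at h0
        simp only [Y, max_eq_left hx0]
        linarith
      have h1 : φ x = M.haz x * M.μ * (1 - M.β) * R x - M.ρ * M.β * R x := by
        simp only [φ, hY, min_self]
        field_simp
      have h2 := mul_pos (H.gainA_pos x (hx.2.le.trans hdP)) (hRpos x)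
      rw [h1]
      simp only [gainA, R] at h2 ⊢
      linarith)
  have hwait : ∀ᵐ x, x ∈ Ioo t d → M.waitP E x ≤ 0 := by
    filter_upwards [E.fakeTime.ae_atom_eq_zero] with x hxa hx
    have hx0 : 0 ≤ x := ht0.trans hx.1.le
    have hx' : x ∈ Ico t d := ⟨hx.1.le, hx.2⟩
    have hexc : M.excess E x ≤ 0 := by
      refine not_lt.1 fun h => ?_
      have hact := H.act_one x hx0 ((M.excess_pos_iff hx0 hxa).1 h)
      have h1 := H.premium_le_slack hx0
      have h2 := hZneg x hx
      rw [hact, mul_one] at h1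
      rw [hZ x hx'] at h2
      linarith
    rw [waitP, max_eq_left hexc]
    have h1 := mul_pos (mul_pos M.ρ_pos M.θ_pos) (M.noFake_pos E x)
    exact mul_nonpos_of_nonneg_of_nonpos (M.disc_pos x).le (by linarith)
  have h3 := H.uP_sub ht0 (ht0.trans htd)
  have h4 : ∫ x in t..d, M.waitP E x ≤ 0 := by
    rw [intervalIntegral.integral_of_le htd, integral_Ioc_eq_integral_Ioo]
    exact setIntegral_nonpos_ae measurableSet_Ioo hwait
  linarith

/-- The first optimal stopping time is the soft deadline: neither player acts before it, and all
later times up to `τP` are optimal stopping times. -/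
lemma exists_softDeadline : ∃ τ, 0 < τ ∧ τ < τP ∧ (∀ t < τ, ¬ E.fakeTime.Charges t) ∧
    (∀ t < τ, ¬ E.stopTime.Charges t) ∧ ∀ t ∈ Icc τ τP, M.uP E t = V := by
  let A : Set ℝ := {s ∈ Icc 0 τP | M.uP E s = V}
  have hAclosed : IsClosed A :=
    (H.uP_continuousOn.mono Icc_subset_Ici_self).preimage_isClosed_of_isClosed isClosed_Icc
      isClosed_singleton
  have hAne : A.Nonempty := ⟨τP, right_mem_Icc.2 H.pos.le, H.stop_at_τP.2⟩
  have hAbdd : BddBelow A := ⟨0, fun s hs => hs.1.1⟩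
  obtain ⟨⟨hτ0, hτP⟩, hτV⟩ : sInf A ∈ A := hAclosed.csInf_mem hAne hAbdd
  set τ := sInf A with hτ
  have hpos : 0 < τ := lt_of_le_of_ne hτ0 fun h => by
    rw [← h, H.uP_zero] at hτV; exact H.lt.ne hτV
  have hbefore : ∀ s, 0 ≤ s → s < τ → M.uP E s ≠ V := fun s hs0 hs h =>
    notMem_of_lt_csInf hs hAbdd ⟨⟨hs0, hs.le.trans hτP⟩, h⟩
  have hf : ∀ t < τ, ¬ E.fakeTime.Charges t := fun t ht h =>
    hbefore t (not_lt.1 fun h' => E.fakeTime.not_charges_of_neg h' h) ht (H.uP_eq_of_fake h)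
  have hs : ∀ t < τ, ¬ E.stopTime.Charges t := fun t ht h =>
    hbefore t (not_lt.1 fun h' => E.stopTime.not_charges_of_neg h' h) ht (H.uP_eq t h)
  refine ⟨τ, hpos, ?_, hf, hs, fun x hx => ?_⟩
  · refine lt_of_le_of_ne hτP fun h => ?_
    have h1 := E.fakeTime.law_eq_zero MeasurableSet.univ fun t _ => by
      rcases lt_or_ge t τP with h2 | h2
      · exact hf t (h ▸ h2)
      · exact H.not_fake_of_ge h2
    rw [E.fakeTime.law_real_univ, H.fake_never] at h1
    norm_num at h1
  · have hx0 : 0 ≤ x := hpos.le.trans hx.1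
    refine le_antisymm (H.uP_le x hx0) (not_lt.1 fun hlt => ?_)
    let B : Set ℝ := {s ∈ Icc τ x | M.uP E s = V}
    have hBclosed : IsClosed B :=
      (H.uP_continuousOn.mono fun s hs => hpos.le.trans hs.1).preimage_isClosed_of_isClosed
        isClosed_Icc isClosed_singleton
    have hBbdd : BddAbove B := ⟨x, fun s hs => hs.1.2⟩
    obtain ⟨⟨hcτ, hcx⟩, hcV⟩ : sSup B ∈ B :=
      hBclosed.csSup_mem ⟨τ, left_mem_Icc.2 hx.1, hτV⟩ hBbdd
    have hcx' : sSup B < x := lt_of_le_of_ne hcx fun h => by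
      rw [h] at hcV; exact hlt.ne hcV
    have h2 := H.uP_lt_of_not_charges (hpos.le.trans hcτ) hcx' hx.2 fun y hy hyc =>
      notMem_of_csSup_lt hy.1 hBbdd ⟨⟨hcτ.trans hy.1.le, hy.2.le⟩, H.uP_eq_of_fake hyc⟩
    linarith

/-- Between the deadlines the principal is indifferent, which determines the density of faking; since
she then gains from news, she responds to it with the risky action. -/
lemma ae_fake_dens {τ : ℝ} (h0 : 0 < τ) (hτ : τ < τP) (hV : ∀ t ∈ Icc τ τP, M.uP E t = V) :
    ∀ᵐ x, x ∈ Ioo τ τP →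
      M.σ * E.fakeTime.dens x = M.gainP x / (M.θ - M.μ) * M.noFake E x ∧
      M.slack E W x = M.alive E x * (M.μ - M.β) := by
  filter_upwards [(M.waitP_intervalIntegrable (E := E) h0.le H.pos.le).ae_hasDerivAt_integral,
    E.fakeTime.ae_atom_eq_zero] with x hx hxa hxI
  have hx0 : 0 ≤ x := h0.le.trans hxI.1.le
  have hd := hx (by rw [uIcc_of_le hτ.le]; exact Ioo_subset_Icc_self hxI) τ left_mem_uIcc
  have hz : HasDerivAt (fun t => ∫ s in τ..t, M.waitP E s) 0 x := by
    refine (hasDerivAt_const x 0).congr_of_eventuallyEq ?_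
    filter_upwards [Ioo_mem_nhds hxI.1 hxI.2] with t ht
    rw [← H.uP_sub h0.le (h0.le.trans ht.1.le), hV t (Ioo_subset_Icc_self ht),
      hV τ (left_mem_Icc.2 hτ.le), sub_self]
  have hw : M.waitP E x = 0 := hd.unique hz
  have hD := M.noFake_pos E x
  have hθμ : 0 < M.θ - M.μ := sub_pos.2 M.μ_lt_θ
  have h1 : max 0 (M.excess E x) = M.ρ * M.θ * M.noFake E x := by
    rcases mul_eq_zero.1 hw with h | h
    · exact absurd h (M.disc_pos x).ne'
    · linarith
  have h2 : 0 < M.ρ * M.θ * M.noFake E x := mul_pos (mul_pos M.ρ_pos M.θ_pos) hD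
  have hexc : 0 < M.excess E x := by
    by_contra h
    rw [max_eq_left (not_lt.1 h)] at h1
    linarith
  rw [max_eq_right hexc.le] at h1
  have hdens : M.σ * E.fakeTime.dens x = M.gainP x / (M.θ - M.μ) * M.noFake E x := by
    rw [excess] at h1
    rw [div_mul_eq_mul_div, eq_div_iff hθμ.ne', gainP]
    linarith
  refine ⟨hdens, ?_⟩
  have hch : E.fakeTime.Charges x := by
    refine Or.inl (pos_of_mul_pos_right ?_ M.σ_pos.le)
    rw [hdens]
    exact mul_pos (div_pos (H.gainP_pos hx0 hxI.2) hθμ) hD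
  rw [← H.premium_eq_slack hch, H.act_one x hx0 ((M.excess_pos_iff hx0 hxa).1 hexc), mul_one]

lemma slack_eq {τ : ℝ} (h0 : 0 < τ) (hτ : τ < τP) (hV : ∀ t ∈ Icc τ τP, M.uP E t = V) {t : ℝ}
    (ht : t ∈ Ico τ τP) : M.slack E W t = M.alive E t * (M.μ - M.β) := by
  have ht0 : 0 ≤ t := h0.le.trans ht.1
  have hlim1 : Tendsto (M.slack E W) (𝓝[>] t) (𝓝 (M.slack E W t)) :=
    (slack_continuousOn t ht0).mono_left (nhdsWithin_mono _ fun x hx => ht0.trans (le_of_lt hx))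
  have hlim2 : Tendsto (fun x => M.alive E x * (M.μ - M.β)) (𝓝[>] t)
      (𝓝 (M.alive E t * (M.μ - M.β))) :=
    ((M.disc_continuous.continuousAt.mono_left nhdsWithin_le_nhds).mul
      ((E.stopTime.cdf_rightCts t).const_sub 1)).mul_const _
  have hfreq : ∃ᶠ x in 𝓝[>] t, M.slack E W x - M.alive E x * (M.μ - M.β) ∈ ({0} : Set ℝ) := by
    refine frequently_iff.2 fun {U} hU => ?_
    obtain ⟨u, hu, hsub⟩ := mem_nhdsGT_iff_exists_Ioo_subset.1 hU
    have hlt : t < min u τP := lt_min hu ht.2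
    have hvol : volume (Ioo t (min u τP)) ≠ 0 := by
      rw [Real.volume_Ioo]
      simpa using hlt
    by_contra! hno
    refine hvol (measure_mono_null (fun x hx => ?_) (ae_iff.1 (H.ae_fake_dens h0 hτ hV)))
    rw [mem_Ioo, lt_min_iff] at hx
    intro h
    have hx' := h ⟨ht.1.trans_lt hx.1, hx.2.2⟩
    exact hno x (hsub ⟨hx.1, hx.2.1⟩) (mem_singleton_iff.2 (sub_eq_zero.2 hx'.2))
  have := isClosed_singleton.mem_of_frequently_of_tendsto hfreq (hlim1.sub hlim2)
  exact sub_eq_zero.1 this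

/-- News is trusted at all times. -/
lemma act_eq_one {τ : ℝ} (h0 : 0 < τ) (hτ : τ < τP) (hf : ∀ t < τ, ¬ E.fakeTime.Charges t)
    (hV : ∀ t ∈ Icc τ τP, M.uP E t = V) {t : ℝ} (ht : 0 ≤ t) : E.act t = 1 := by
  rcases lt_or_ge t τ with h1 | h1
  · exact H.act_of_not_charges ht (hf t h1)
  rcases lt_or_ge t τP with h2 | h2
  · have h3 := H.premium_eq_min ht
    rw [H.slack_eq h0 hτ hV ⟨h1, h2⟩, min_self, mul_right_comm] at h3
    exact mul_left_cancel₀ (mul_pos (H.alive_pos h2) μ_sub_β_pos).ne' (by rw [h3, mul_one])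
  · exact H.act_of_not_charges ht (H.not_fake_of_ge h2)

lemma fake_atom_eq_zero {τ : ℝ} (h0 : 0 < τ) (hτ : τ < τP)
    (hf : ∀ t < τ, ¬ E.fakeTime.Charges t) (hV : ∀ t ∈ Icc τ τP, M.uP E t = V) (t : ℝ) :
    E.fakeTime.atom t = 0 := by
  refine le_antisymm (not_lt.1 fun h => ?_) (E.fakeTime.atom_nonneg t)
  have ht : 0 ≤ t := not_lt.1 fun h' => h.ne' (E.fakeTime.atom_of_neg t h')
  have h1 := H.act_zero t ht (by rw [M.belief_of_atom h]; exact M.μ_lt_θ)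
  rw [H.act_eq_one h0 hτ hf hV ht] at h1
  exact one_ne_zero h1

omit H in
lemma cdf_eq_zero_of_not_charges {S : MixedTime} {τ : ℝ} (h : ∀ t < τ, ¬ S.Charges t) {t : ℝ}
    (ht : t < τ) : S.cdf t = 0 := by
  rw [S.cdf_eq]
  exact S.law_eq_zero measurableSet_Iic fun x hx => h x (lt_of_le_of_lt hx ht)

lemma noFake_eq {τ : ℝ} (h0 : 0 < τ) (hτ : τ < τP) (hf : ∀ t < τ, ¬ E.fakeTime.Charges t)
    (hV : ∀ t ∈ Icc τ τP, M.uP E t = V) {t : ℝ} (ht : t ∈ Icc τ τP) :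
    M.noFake E t = exp (-∫ s in τ..t, M.gainP s / (M.θ - M.μ)) := by
  have hcdf : ∀ x ∈ Icc τ τP, E.fakeTime.cdf x = ∫ s in τ..x, E.fakeTime.dens s := fun x hx => by
    have hτ0 : E.fakeTime.law.real (Iic τ) = 0 := by
      have h1 : E.fakeTime.law.real (Iio τ) = 0 :=
        E.fakeTime.law_eq_zero measurableSet_Iio fun s hs => hf s hs
      rw [← Iio_union_right, measureReal_union (by simp) (measurableSet_singleton τ), h1,
        E.fakeTime.law_singleton, H.fake_atom_eq_zero h0 hτ hf hV, add_zero]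
    have h2 := E.fakeTime.cdf_sub τ x hx.1
    rw [E.fakeTime.cdf_eq τ, hτ0, sub_zero, E.fakeTime.law_real measurableSet_Ioc] at h2
    rw [h2, intervalIntegral.integral_of_le hx.1]
    have h3 : ∀ s, (Ioc τ x).indicator E.fakeTime.atom s = 0 := fun s => by
      rw [indicator_apply_eq_zero]
      exact fun _ => H.fake_atom_eq_zero h0 hτ hf hV s
    simp [h3]
  have hint : ∀ a b, IntervalIntegrable E.fakeTime.dens volume a b := fun a b =>
    E.fakeTime.dens_integrable.intervalIntegrable
  have hD : ∀ x ∈ Icc τ τP, M.noFake E x = 1 - M.σ * ∫ s in τ..x, E.fakeTime.dens s :=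
    fun x hx => by rw [noFake, hcdf x hx]
  have hτmem : τ ∈ Icc τ τP := left_mem_Icc.2 hτ.le
  have hDτ : M.noFake E τ = 1 := by rw [hD τ hτmem]; simp
  have hcont : ContinuousOn (M.noFake E) (Icc τ τP) :=
    (continuous_const.sub (continuous_const.mul
      (intervalIntegral.continuous_primitive hint τ))).continuousOn.congr hD
  have key := eq_mul_exp_of_integral_eq (q := fun s => -(M.gainP s / (M.θ - M.μ))) hτ.le hcont
    (M.gainP_continuous.div_const _).neg (fun x hx => by
      rw [hDτ, hD x hx, ← intervalIntegral.integral_const_mul, sub_eq_add_neg,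
        ← intervalIntegral.integral_neg]
      congr 1
      rw [intervalIntegral.integral_of_le hx.1, intervalIntegral.integral_of_le hx.1,
        integral_Ioc_eq_integral_Ioo, integral_Ioc_eq_integral_Ioo]
      refine setIntegral_congr_ae measurableSet_Ioo ?_
      filter_upwards [H.ae_fake_dens h0 hτ hV] with s hs hsI
      rw [(hs ⟨hsI.1, hsI.2.trans_le hx.2⟩).1]
      ring) t ht
  rw [key, hDτ, one_mul, intervalIntegral.integral_neg]

/-- There is no atom of stopping at the soft deadline: otherwise the agent would gain from faking
just before. -/
lemma stop_cdf_softDeadline {τ : ℝ} (h0 : 0 < τ) (hτ : τ < τP)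
    (hf : ∀ t < τ, ¬ E.fakeTime.Charges t) (hs : ∀ t < τ, ¬ E.stopTime.Charges t)
    (hV : ∀ t ∈ Icc τ τP, M.uP E t = V) : E.stopTime.cdf τ = 0 := by
  have hle : M.disc τ * (M.μ - M.β) ≤ M.slack E W τ := by
    have hlim1 : Tendsto (M.slack E W) (𝓝[<] τ) (𝓝 (M.slack E W τ)) :=
      (slack_continuousOn.continuousAt (Ici_mem_nhds h0)).mono_left nhdsWithin_le_nhds
    have hlim2 : Tendsto (fun x => M.disc x * (M.μ - M.β)) (𝓝[<] τ)
        (𝓝 (M.disc τ * (M.μ - M.β))) :=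
      ((M.disc_continuous.mul continuous_const).continuousAt).mono_left nhdsWithin_le_nhds
    refine le_of_tendsto_of_tendsto hlim2 hlim1 ?_
    filter_upwards [Ioo_mem_nhdsLT h0] with x hx
    have h1 := H.premium_le_slack hx.1.le
    rwa [H.act_eq_one h0 hτ hf hV hx.1.le, alive, cdf_eq_zero_of_not_charges hs hx.2, sub_zero,
      mul_one, mul_one] at h1
  rw [H.slack_eq h0 hτ hV ⟨le_rfl, hτ⟩, alive] at hle
  have h2 := le_of_mul_le_mul_right hle μ_sub_β_pos
  have h3 := mul_pos (M.disc_pos τ) (M.disc_pos τ)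
  have h4 := E.stopTime.cdf_nonneg τ
  have h5 : M.disc τ * E.stopTime.cdf τ ≤ 0 := by linarith
  exact le_antisymm (nonpos_of_mul_nonpos_right h5 (M.disc_pos τ)) h4

lemma stop_cdf_eq {τ : ℝ} (h0 : 0 < τ) (hτ : τ < τP)
    (hf : ∀ t < τ, ¬ E.fakeTime.Charges t) (hs : ∀ t < τ, ¬ E.stopTime.Charges t)
    (hV : ∀ t ∈ Icc τ τP, M.uP E t = V) {t : ℝ} (ht : t ∈ Ico τ τP) :
    E.stopTime.cdf t = 1 - exp (-∫ s in τ..t, M.gainA s / (M.μ - M.β)) := by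
  have hμβ := μ_sub_β_pos (M := M)
  let q : ℝ → ℝ := fun s => -((M.haz s * M.μ * (1 - M.β) - M.ρ * M.β) / (M.μ - M.β))
  have hq : Continuous q := by
    have := M.haz_continuous
    simp only [q]; fun_prop
  have hY := eq_mul_exp_of_integral_eq (f := M.slack E W) (q := q) ht.1
    (slack_continuousOn.mono fun x hx => h0.le.trans hx.1) hq (fun x hx => by
      rw [slack_sub h0.le (h0.le.trans hx.1), sub_eq_add_neg, ← intervalIntegral.integral_neg]
      congr 1
      refine intervalIntegral.integral_congr fun s hs' => ?_
      rw [uIcc_of_le hx.1] at hs'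
      simp only [q]
      rw [H.slack_eq h0 hτ hV ⟨hs'.1, (hs'.2.trans hx.2).trans_lt ht.2⟩, waitA,
        H.act_eq_one h0 hτ hf hV (h0.le.trans hs'.1)]
      field_simp) t (right_mem_Icc.2 ht.1)
  rw [H.slack_eq h0 hτ hV ht, H.slack_eq h0 hτ hV ⟨le_rfl, hτ⟩, alive, alive,
    H.stop_cdf_softDeadline h0 hτ hf hs hV, sub_zero, mul_one] at hY
  have hK : M.disc t = M.disc τ * exp (-∫ s in τ..t, (M.ρ + M.haz s)) := by
    rw [disc, disc, ← exp_add, ← neg_add, intervalIntegral.integral_add_adjacent_intervals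
      (M.continuous_rho_add_haz.intervalIntegrable _ _)
      (M.continuous_rho_add_haz.intervalIntegrable _ _)]
  have hsum : ∫ s in τ..t, q s =
      -(∫ s in τ..t, (M.ρ + M.haz s)) - ∫ s in τ..t, M.gainA s / (M.μ - M.β) := by
    have hn : Continuous fun s => -(M.ρ + M.haz s) := M.continuous_rho_add_haz.neg
    rw [← intervalIntegral.integral_neg, ← intervalIntegral.integral_sub
      (hn.intervalIntegrable _ _)
      ((M.gainA_continuous.div_const _).intervalIntegrable _ _)]
    refine intervalIntegral.integral_congr fun s _ => ?_
    simp only [q, gainA]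
    field_simp
    ring
  rw [hsum, sub_eq_add_neg (-(∫ s in τ..t, (M.ρ + M.haz s))), exp_add, hK] at hY
  have hpos : M.disc τ * exp (-∫ s in τ..t, (M.ρ + M.haz s)) * (M.μ - M.β) ≠ 0 :=
    (mul_pos (mul_pos (M.disc_pos τ) (exp_pos _)) hμβ).ne'
  have hfin : 1 - E.stopTime.cdf t = exp (-∫ s in τ..t, M.gainA s / (M.μ - M.β)) :=
    mul_left_cancel₀ hpos (by linear_combination hY)
  linarith

end BeneficialValues

end SearchModel

/-! ### Existence of a beneficial equilibrium -/

lemma integral_mul_exp_neg_integral {q : ℝ → ℝ} (hq : Continuous q) (a t : ℝ) :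
    ∫ s in a..t, q s * exp (-∫ x in a..s, q x) = 1 - exp (-∫ x in a..t, q x) := by
  have hd : ∀ s, HasDerivAt (fun s => -exp (-∫ x in a..s, q x)) (q s * exp (-∫ x in a..s, q x)) s :=
    fun s => (hq.integral_hasStrictDerivAt a s).hasDerivAt.fun_neg.exp.fun_neg.congr_deriv (by ring)
  have hc : Continuous fun s => q s * exp (-∫ x in a..s, q x) :=
    hq.mul (Real.continuous_exp.comp
      (intervalIntegral.continuous_primitive (fun _ _ => hq.intervalIntegrable _ _) a).neg)
  rw [intervalIntegral.integral_eq_sub_of_hasDerivAt (fun s _ => hd s)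
    (hc.intervalIntegrable _ _)]
  simp
  ring

/-- A mixed strategy whose hazard rate on `[a, b)` is `q`, with the density rescaled by `k`, and with
the remaining mass `m` in an atom at `b`. -/
lemma MixedTime.exists_of_hazard {q : ℝ → ℝ} {a b k m : ℝ} (hq : Continuous q) (ha : 0 ≤ a)
    (hab : a < b) (hq0 : ∀ x ∈ Ico a b, 0 ≤ q x) (hk : 0 ≤ k) (hm : 0 ≤ m)
    (hmass : k * (1 - exp (-∫ x in a..b, q x)) + m = 1) :
    ∃ S : MixedTime,
      (∀ t, S.dens t = (Ico a b).indicator (fun t => k * (q t * exp (-∫ x in a..t, q x))) t) ∧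
      (∀ t, S.atom t = if t = b then m else 0) ∧ S.never = 0 ∧
      (∀ t < a, S.cdf t = 0) ∧
      (∀ t ∈ Ico a b, S.cdf t = k * (1 - exp (-∫ x in a..t, q x))) ∧ ∀ t ≥ b, S.cdf t = 1 := by
  let f : ℝ → ℝ := fun t => k * (q t * exp (-∫ x in a..t, q x))
  have hf : Continuous f :=
    continuous_const.mul (hq.mul (Real.continuous_exp.comp
      (intervalIntegral.continuous_primitive (fun _ _ => hq.intervalIntegrable _ _) a).neg))
  have hfint : ∀ t, ∫ s in a..t, f s = k * (1 - exp (-∫ x in a..t, q x)) := fun t => by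
    rw [← integral_mul_exp_neg_integral hq, ← intervalIntegral.integral_const_mul]
  have htotal : ∫ t, (Ico a b).indicator f t = k * (1 - exp (-∫ x in a..b, q x)) := by
    rw [integral_indicator measurableSet_Ico, integral_Ico_eq_integral_Ioc,
      ← intervalIntegral.integral_of_le hab.le, hfint]
  have hatom : HasSum (fun t => if t = b then m else 0) m := hasSum_ite_eq b m
  refine ⟨{
    dens := (Ico a b).indicator f
    atom := fun t => if t = b then m else 0
    dens_nonneg := fun t => indicator_nonneg (fun x hx => mul_nonneg hk
      (mul_nonneg (hq0 x hx) (exp_pos _).le)) t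
    atom_nonneg := fun t => by split_ifs <;> simp [hm]
    dens_of_neg := fun t ht => indicator_of_notMem (fun h => absurd (ha.trans h.1) (not_le.2 ht)) _
    atom_of_neg := fun t ht => if_neg fun h => absurd (ha.trans hab.le) (by rw [← h]; exact not_le.2 ht)
    dens_measurable := hf.measurable.indicator measurableSet_Ico
    dens_integrable := (integrable_indicator_iff measurableSet_Ico).2
      ((hf.integrableOn_Icc (a := a) (b := b)).mono_set Ico_subset_Icc_self)
    atom_summable := hatom.summable
    mass_le_one := by rw [htotal, hatom.tsum_eq, hmass] }, fun _ => rfl, fun _ => rfl, ?_, ?_, ?_, ?_⟩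
  · simp only [never]
    rw [htotal, hatom.tsum_eq, hmass, sub_self]
  all_goals
    intro t ht
    simp only [cdf]
    rw [setIntegral_indicator measurableSet_Ico, tsum_eq_single b (fun s hs => by simp [hs])]
  · have : Iic t ∩ Ico a b = ∅ := by
      ext x; simp only [mem_inter_iff, mem_Iic, mem_Ico, mem_empty_iff_false, iff_false]
      rintro ⟨h1, h2, -⟩; linarith
    rw [this, if_neg (by linarith)]
    simp
  · have : Iic t ∩ Ico a b = Icc a t := by
      ext x; simp only [mem_inter_iff, mem_Iic, mem_Ico, mem_Icc]
      exact ⟨fun h => ⟨h.2.1, h.1⟩, fun h => ⟨h.2, h.1, h.2.trans_lt ht.2⟩⟩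
    rw [this, if_neg (not_le.2 ht.2), integral_Icc_eq_integral_Ioc,
      ← intervalIntegral.integral_of_le ht.1, hfint, add_zero]
  · have : Iic t ∩ Ico a b = Ico a b :=
      inter_eq_right.2 fun x hx => hx.2.le.trans ht
    rw [this, if_pos ht, if_pos rfl, integral_Ico_eq_integral_Ioc,
      ← intervalIntegral.integral_of_le hab.le, hfint, hmass]

namespace SearchModel

variable {M : SearchModel}

lemma integral_rate_pos {q : ℝ → ℝ} {b s t : ℝ} (hq : Continuous q)
    (hpos : ∀ x, 0 ≤ x → x < b → 0 < q x) (hs : 0 ≤ s) (hst : s < t) (ht : t ≤ b) :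
    0 < ∫ x in s..t, q x :=
  intervalIntegral.intervalIntegral_pos_of_pos_on (hq.intervalIntegrable _ _)
    (fun x hx => hpos x (hs.trans hx.1.le) (hx.2.trans_le ht)) hst

lemma gainP_div_pos {τP : ℝ} (hg : M.gainP τP = 0) :
    ∀ x, 0 ≤ x → x < τP → 0 < M.gainP x / (M.θ - M.μ) := fun _ h0 hx =>
  div_pos (hg ▸ M.gainP_lt h0 hx) (sub_pos.2 M.μ_lt_θ)

lemma exists_softDeadlineEq {τP : ℝ} (h0 : 0 < τP)
    (hσ : M.σ < M.sigmaBar τP) :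
    ∃ τ, 0 < τ ∧ τ < τP ∧ M.σ = 1 - exp (-∫ s in τ..τP, M.gainP s / (M.θ - M.μ)) := by
  let q : ℝ → ℝ := fun s => M.gainP s / (M.θ - M.μ)
  have hq : Continuous q := M.gainP_continuous.div_const _
  let F : ℝ → ℝ := fun t => 1 - exp (-∫ s in t..τP, q s)
  have hF : Continuous F := by
    have h1 : Continuous fun t => ∫ s in τP..t, q s :=
      intervalIntegral.continuous_primitive (fun _ _ => hq.intervalIntegrable _ _) τP
    have h2 : F = fun t => 1 - exp (∫ s in τP..t, q s) := by
      ext t; simp only [F]; rw [intervalIntegral.integral_symm, neg_neg]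
    rw [h2]; fun_prop
  have hF0 : M.σ < F 0 := by
    rw [sigmaBar, M.integral_rateA le_rfl h0.le] at hσ
    exact hσ
  have hFP : F τP < M.σ := by simp only [F]; simpa using M.σ_pos
  obtain ⟨τ, hτ, hFτ⟩ := intermediate_value_Ioo' h0.le hF.continuousOn ⟨hFP, hF0⟩
  exact ⟨τ, hτ.1, hτ.2, hFτ.symm⟩

/-- News is trusted at all times, faking has hazard rate `gainP / (θ - μ)` up to the rescaling by `σ`,
which makes the principal indifferent, and stopping has hazard rate `gainA / (μ - β)`, which makes the
agent indifferent. -/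
theorem exists_beneficialEquilibrium (hA2 : M.A2) {τP : ℝ} (h0 : 0 < τP) (hg : M.gainP τP = 0)
    (hσ : M.σ < M.sigmaBar τP) : ∃ E, M.IsBeneficialEquilibrium E := by
  obtain ⟨τ, hτ0, hτP, hτσ⟩ := exists_softDeadlineEq h0 hσ
  have hθμ : 0 < M.θ - M.μ := sub_pos.2 M.μ_lt_θ
  have hμβ : 0 < M.μ - M.β := sub_pos.2 M.β_lt_μ
  have hgA : ∀ t ≤ τP, 0 < M.gainA t := fun t ht => gainA_pos_of_le hA2 hg ht
  let qA : ℝ → ℝ := fun s => M.gainP s / (M.θ - M.μ)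
  let qP : ℝ → ℝ := fun s => M.gainA s / (M.μ - M.β)
  have hqA : Continuous qA := M.gainP_continuous.div_const _
  have hqP : Continuous qP := M.gainA_continuous.div_const _
  obtain ⟨A, hAd, hAa, hAn, hA0, hA1, hA2'⟩ := MixedTime.exists_of_hazard (k := 1 / M.σ) (m := 0)
    hqA hτ0.le hτP (fun x hx => (gainP_div_pos hg x (hτ0.le.trans hx.1) hx.2).le)
    (one_div_pos.2 M.σ_pos).le le_rfl (by
      rw [← hτσ, add_zero, one_div_mul_cancel M.σ_pos.ne'])
  obtain ⟨P, hPd, hPa, hPn, hP0, hP1, hP2⟩ := MixedTime.exists_of_hazard (k := 1)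
    (m := exp (-∫ x in τ..τP, qP x)) hqP hτ0.le hτP
    (fun x hx => (div_pos (hgA x hx.2.le) hμβ).le) zero_le_one (exp_pos _).le (by ring)
  let E : Profile :=
    { act := fun _ => 1
      act_mem := fun _ => ⟨zero_le_one, le_rfl⟩
      act_measurable := measurable_const
      stopTime := P
      fakeTime := A }
  have hAatom : ∀ t, E.fakeTime.atom t = 0 := fun t => by
    change A.atom t = 0
    rw [hAa, ite_self]
  have hAdens : ∀ t ∉ Ico τ τP, E.fakeTime.dens t = 0 := fun t ht =>
    (hAd t).trans (indicator_of_notMem ht _)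
  have hDmid : ∀ t ∈ Ico τ τP, M.noFake E t = exp (-∫ x in τ..t, qA x) := fun t ht => by
    change 1 - M.σ * A.cdf t = _
    rw [hA1 t ht, ← mul_assoc, mul_one_div_cancel M.σ_pos.ne']
    ring
  have hDpre : ∀ t < τ, M.noFake E t = 1 := fun t ht => by
    change 1 - M.σ * A.cdf t = _
    rw [hA0 t ht, mul_zero, sub_zero]
  have hexc_mid : ∀ t ∈ Ico τ τP, M.excess E t = M.ρ * M.θ * M.noFake E t := fun t ht => by
    have h1 : M.σ * E.fakeTime.dens t = qA t * M.noFake E t := by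
      rw [hDmid t ht, show E.fakeTime.dens t = _ from hAd t, indicator_of_mem ht, ← mul_assoc,
        mul_one_div_cancel M.σ_pos.ne', one_mul]
    rw [excess, h1, ← mul_assoc, mul_div_cancel₀ _ hθμ.ne', gainP]
    ring
  have hexc_out : ∀ t ∉ Ico τ τP, M.excess E t = M.μ * (1 - M.θ) * M.haz t * M.noFake E t :=
    fun t ht => by rw [excess, hAdens t ht, mul_zero, mul_zero, sub_zero]
  have hexc : ∀ t, 0 < M.excess E t := fun t => by
    by_cases ht : t ∈ Ico τ τP
    · rw [hexc_mid t ht]; exact mul_pos (mul_pos M.ρ_pos M.θ_pos) (M.noFake_pos E t)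
    · rw [hexc_out t ht]; exact M.news_coeff_pos t
  have hact0 : ∀ t, 0 ≤ t → M.belief E.fakeTime t < M.θ → E.act t = 0 := fun t ht h =>
    absurd h (not_lt.2 ((M.excess_pos_iff ht (hAatom t)).1 (hexc t)).le)
  obtain ⟨hu, hulim⟩ := M.uP_eq_and_tendsto (E := E) (fun _ _ _ => rfl) hact0
  have hwP_pre : ∀ t < τ, M.waitP E t = M.disc t * M.gainP t := fun t ht => by
    rw [waitP, max_eq_right (hexc t).le, hexc_out t fun h => absurd h.1 (not_le.2 ht),
      hDpre t ht, gainP]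
    ring
  have hwP_mid : ∀ t ∈ Ico τ τP, M.waitP E t = 0 := fun t ht => by
    rw [waitP, max_eq_right (hexc t).le, hexc_mid t ht, sub_self, mul_zero]
  have hwP_le : ∀ t, τ ≤ t → M.waitP E t ≤ 0 := fun t ht => by
    rcases lt_or_ge t τP with h | h
    · exact (hwP_mid t ⟨ht, h⟩).le
    · refine (M.waitP_le t).trans ?_
      have h2 : M.gainP t ≤ 0 := by
        rcases h.eq_or_lt with h3 | h3
        · rw [← h3, hg]
        · exact (hg ▸ M.gainP_lt h0.le h3).le
      exact mul_nonpos_of_nonneg_of_nonpos (M.disc_pos t).le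
        (mul_nonpos_of_nonpos_of_nonneg h2 (M.noFake_pos E t).le)
  have husub : ∀ s t, 0 ≤ s → 0 ≤ t → M.uP E t - M.uP E s = ∫ x in s..t, M.waitP E x :=
    fun s t hs ht => by
      rw [hu s hs, hu t ht, ← intervalIntegral.integral_interval_sub_left
        (M.waitP_intervalIntegrable le_rfl ht) (M.waitP_intervalIntegrable le_rfl hs)]
      ring
  have huP_lt : ∀ s, 0 ≤ s → s < τ → M.uP E s < M.uP E τ := fun s hs hsτ => by
    rw [← sub_pos, husub s τ hs hτ0.le]
    refine intervalIntegral.intervalIntegral_pos_of_pos_on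
      (M.waitP_intervalIntegrable hs hτ0.le) (fun x hx => ?_) hsτ
    rw [hwP_pre x hx.2]
    exact mul_pos (M.disc_pos x) (hg ▸ M.gainP_lt (hs.trans hx.1.le) (hx.2.trans hτP))
  have huP_le : ∀ t, 0 ≤ t → M.uP E t ≤ M.uP E τ := fun t ht => by
    rcases lt_or_ge t τ with h | h
    · exact (huP_lt t ht h).le
    · have h1 := husub τ t hτ0.le ht
      have h2 : ∫ x in τ..t, M.waitP E x ≤ 0 := by
        rw [intervalIntegral.integral_of_le h]
        exact setIntegral_nonpos measurableSet_Ioc fun x hx => hwP_le x hx.1.le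
      linarith
  have huP_eq : ∀ t ∈ Icc τ τP, M.uP E t = M.uP E τ := fun t ht => by
    have h1 := husub τ t hτ0.le (hτ0.le.trans ht.1)
    have h2 : ∫ x in τ..t, M.waitP E x = 0 := by
      rw [intervalIntegral.integral_of_le ht.1, integral_Ioc_eq_integral_Ioo]
      refine setIntegral_eq_zero_of_forall_eq_zero fun x hx => ?_
      exact hwP_mid x ⟨hx.1.le, hx.2.trans_le ht.2⟩
    linarith
  have hoptP : E.stopTime.Optimal (M.uP E) (M.uPInf E) := by
    refine ⟨fun t ht hc => ?_, fun hn => absurd hn (by rw [show E.stopTime.never = 0 from hPn]; simp)⟩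
    have htI : t ∈ Icc τ τP := by
      by_contra hno
      have h1 : P.dens t = 0 :=
        (hPd t).trans (indicator_of_notMem (fun h => hno (Ico_subset_Icc_self h)) _)
      have h2 : P.atom t = 0 := by
        rw [hPa, if_neg]; rintro rfl; exact hno (right_mem_Icc.2 hτP.le)
      rcases hc with h | h
      · exact h.ne' h1
      · exact h.ne' h2
    rw [huP_eq t htI]
    exact ⟨huP_le, le_of_tendsto hulim ((eventually_ge_atTop 0).mono huP_le)⟩
  -- the discounted probability that the game goes on, without the atom of stopping at `τP`
  let R : ℝ → ℝ := fun t => M.disc t * exp (-∫ x in τ..t, qP x)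
  have hRτ : R τ = M.disc τ := by simp [R]
  have hRd : ∀ t, HasDerivAt (fun t => -(R t * (M.μ - M.β)))
      (R t * (M.haz t * M.μ * (1 - M.β) - M.ρ * M.β)) t := fun t => by
    refine (((M.hasDerivAt_disc t).mul
      (hqP.integral_hasStrictDerivAt τ t).hasDerivAt.fun_neg.exp).mul_const
        (M.μ - M.β)).fun_neg.congr_deriv ?_
    have h1 : qP t * (M.μ - M.β) = M.gainA t := div_mul_cancel₀ _ hμβ.ne'
    rw [gainA] at h1
    simp only [R]
    linear_combination (M.disc t * exp (-∫ x in τ..t, qP x)) * h1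
  have hRc : Continuous fun t => R t * (M.haz t * M.μ * (1 - M.β) - M.ρ * M.β) := by
    have h1 : Continuous fun t => ∫ x in τ..t, qP x :=
      intervalIntegral.continuous_primitive (fun _ _ => hqP.intervalIntegrable _ _) τ
    have h2 := M.disc_continuous
    have h3 := M.haz_continuous
    simp only [R]
    fun_prop
  have halive_pre : ∀ t < τ, M.alive E t = M.disc t := fun t ht => by
    change M.disc t * (1 - P.cdf t) = _
    rw [hP0 t ht, sub_zero, mul_one]
  have halive_mid : ∀ t ∈ Ico τ τP, M.alive E t = R t := fun t ht => by
    change M.disc t * (1 - P.cdf t) = M.disc t * _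
    rw [hP1 t ht]; ring
  have halive_post : ∀ t ≥ τP, M.alive E t = 0 := fun t ht => by
    change M.disc t * (1 - P.cdf t) = _
    rw [hP2 t ht, sub_self, mul_zero]
  obtain ⟨hv, hvlim⟩ := M.uA_eq_and_tendsto (E := E)
  have hv' : ∀ t, 0 ≤ t → M.uA E t = M.β + (∫ s in (0 : ℝ)..t, M.waitA E s)
      + M.alive E t * (M.μ - M.β) := fun t ht => by
    rw [hv t ht, show E.act t = 1 from rfl, mul_one]
  have hvsub : ∀ s t, 0 ≤ s → 0 ≤ t → M.uA E t - M.uA E s = (∫ x in s..t, M.waitA E x)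
      + (M.alive E t - M.alive E s) * (M.μ - M.β) := fun s t hs ht => by
    rw [hv' s hs, hv' t ht, ← intervalIntegral.integral_interval_sub_left
      (M.waitA_intervalIntegrable le_rfl ht) (M.waitA_intervalIntegrable le_rfl hs)]
    ring
  have hwA_mid : ∀ t ∈ Icc τ τP, ∫ x in τ..t, M.waitA E x = (R τ - R t) * (M.μ - M.β) :=
    fun t ht => by
      have h1 := intervalIntegral.integral_eq_sub_of_hasDerivAt
        (fun x (_ : x ∈ uIcc τ t) => hRd x) (hRc.intervalIntegrable _ _)
      have h2 : ∫ x in τ..t, M.waitA E x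
          = ∫ x in τ..t, R x * (M.haz x * M.μ * (1 - M.β) - M.ρ * M.β) := by
        rw [intervalIntegral.integral_of_le ht.1, intervalIntegral.integral_of_le ht.1,
          integral_Ioc_eq_integral_Ioo, integral_Ioc_eq_integral_Ioo]
        refine setIntegral_congr_fun measurableSet_Ioo fun x hx => ?_
        simp only [waitA]
        rw [halive_mid x ⟨hx.1.le, hx.2.trans_le ht.2⟩, show E.act x = 1 from rfl, mul_one]
      rw [h2, h1]; ring
  have hvτ : M.alive E τ = R τ := halive_mid τ ⟨le_rfl, hτP⟩
  have hv_eq : ∀ t ∈ Ico τ τP, M.uA E t = M.uA E τ := fun t ht => by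
    have h1 := hvsub τ t hτ0.le (hτ0.le.trans ht.1)
    rw [hwA_mid t (Ico_subset_Icc_self ht), halive_mid t ht, hvτ] at h1
    linarith
  have hv_le : ∀ t, 0 ≤ t → M.uA E t ≤ M.uA E τ := fun t ht => by
    rcases lt_or_ge t τ with h | h
    · have h1 := hvsub t τ ht hτ0.le
      have h2 : ∫ x in t..τ, M.waitA E x
          = ∫ x in t..τ, M.disc x * (M.haz x * M.μ * (1 - M.β) - M.ρ * M.β) := by
        rw [intervalIntegral.integral_of_le h.le, intervalIntegral.integral_of_le h.le,
          integral_Ioc_eq_integral_Ioo, integral_Ioc_eq_integral_Ioo]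
        refine setIntegral_congr_fun measurableSet_Ioo fun x hx => ?_
        simp only [waitA]
        rw [halive_pre x hx.2, show E.act x = 1 from rfl, mul_one]
      have hd := M.disc_continuous
      have hh := M.haz_continuous
      have h3 : 0 ≤ ∫ x in t..τ, M.disc x * M.gainA x :=
        intervalIntegral.integral_nonneg h.le fun x hx =>
          (mul_pos (M.disc_pos x) (hgA x (hx.2.trans hτP.le))).le
      have h4 : ∫ x in t..τ, M.disc x * M.gainA x
          = (∫ x in t..τ, M.disc x * (M.haz x * M.μ * (1 - M.β) - M.ρ * M.β))
            + (∫ x in t..τ, -((M.ρ + M.haz x) * M.disc x)) * (M.μ - M.β) := by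
        rw [← intervalIntegral.integral_mul_const, ← intervalIntegral.integral_add]
        · refine intervalIntegral.integral_congr fun x _ => ?_
          simp only [gainA]; ring
        all_goals exact Continuous.intervalIntegrable (by fun_prop) _ _
      rw [M.integral_deriv_disc] at h4
      rw [h2, hvτ, hRτ, halive_pre t h] at h1
      linarith
    · rcases lt_or_ge t τP with h' | h'
      · exact (hv_eq t ⟨h, h'⟩).le
      · have h1 := hvsub τ τP hτ0.le h0.le
        have h2 := hvsub τP t h0.le ht
        have h3 : ∫ x in τP..t, M.waitA E x = 0 := by
          refine (intervalIntegral.integral_congr (g := fun _ => 0) fun s hs => ?_).trans (by simp)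
          rw [uIcc_of_le h'] at hs
          simp only [waitA, halive_post s hs.1, zero_mul]
        have h4 : 0 < R τP * (M.μ - M.β) := mul_pos (mul_pos (M.disc_pos _) (exp_pos _)) hμβ
        rw [hwA_mid τP (right_mem_Icc.2 hτP.le), halive_post τP le_rfl, hvτ] at h1
        rw [h3, halive_post τP le_rfl, halive_post t h'] at h2
        linarith
  have hoptA : E.fakeTime.Optimal (M.uA E) (M.uAInf E) := by
    refine ⟨fun t ht hc => ?_, fun hn => absurd hn (by rw [show E.fakeTime.never = 0 from hAn]; simp)⟩
    have htI : t ∈ Ico τ τP := by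
      by_contra hno
      rcases hc with h | h
      · exact h.ne' (hAdens t hno)
      · exact h.ne' (hAatom t)
    rw [hv_eq t htI]
    exact ⟨hv_le, le_of_tendsto hvlim ((eventually_ge_atTop 0).mono hv_le)⟩
  refine ⟨E, ⟨hoptA, fun _ _ _ => rfl, hact0, hoptP⟩, ?_⟩
  obtain ⟨V, -, hV, -, hpay⟩ := hoptP.exists_value
  have hcharge : E.stopTime.Charges τP := by
    right
    change 0 < P.atom τP
    rw [hPa, if_pos rfl]
    exact exp_pos _
  have h1 := huP_lt 0 le_rfl hτ0
  rw [hu 0 le_rfl, intervalIntegral.integral_same, add_zero] at h1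
  rw [payoffP, hpay, ← hV τP hcharge, huP_eq τP (right_mem_Icc.2 hτP.le)]
  exact h1

end SearchModel

/-! ### Description and uniqueness of the equilibrium -/

lemma MixedTime.support_eq_Icc {S : MixedTime} {a b : ℝ} (hab : a < b) (h0 : ∀ t < a, S.cdf t = 0)
    (h1 : ∀ t ≥ b, S.cdf t = 1) (hmono : StrictMonoOn S.cdf (Icc a b)) : S.support = Icc a b := by
  ext t
  constructor
  · intro ht
    by_contra hno
    rw [mem_Icc, not_and_or, not_le, not_le] at hno
    rcases hno with h | h
    · have := ht ((a - t) / 2) (by linarith)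
      rw [h0 _ (by linarith), h0 _ (by linarith)] at this
      exact lt_irrefl _ this
    · have := ht (t - b) (by linarith)
      rw [h1 _ (by linarith), h1 _ (by linarith)] at this
      exact lt_irrefl _ this
  · intro ht ε hε
    have hlt : max (t - ε) a < min (t + ε) b :=
      max_lt (lt_min (by linarith) (by linarith [ht.2])) (lt_min (by linarith [ht.1]) hab)
    calc S.cdf (t - ε) ≤ S.cdf (max (t - ε) a) := S.cdf_mono (le_max_left _ _)
      _ < S.cdf (min (t + ε) b) := hmono ⟨le_max_right _ _, (hlt.trans_le (min_le_right _ _)).le⟩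
          ⟨(le_max_right _ _).trans hlt.le, min_le_right _ _⟩ hlt
      _ ≤ S.cdf (t + ε) := S.cdf_mono (min_le_left _ _)

lemma strictMonoOn_one_sub_exp {q : ℝ → ℝ} {a b : ℝ} (hq : Continuous q) (ha : 0 ≤ a)
    (hpos : ∀ x, 0 ≤ x → x < b → 0 < q x) :
    StrictMonoOn (fun t => 1 - exp (-∫ x in a..t, q x)) (Icc a b) := fun s hs t ht hst => by
  have h1 := SearchModel.integral_rate_pos hq hpos (ha.trans hs.1) hst ht.2
  have h2 := intervalIntegral.integral_add_adjacent_intervals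
    (hq.intervalIntegrable (μ := volume) a s) (hq.intervalIntegrable s t)
  have h3 : exp (-∫ x in a..t, q x) < exp (-∫ x in a..s, q x) := exp_lt_exp.2 (by linarith)
  simp only
  linarith

namespace SearchModel

variable {M : SearchModel}

lemma softDeadlineEq_iff {τP τ : ℝ} (h0 : 0 ≤ τP) (hτ : 0 ≤ τ) :
    M.SoftDeadlineEq τP τ ↔ 1 - exp (-∫ s in τ..τP, M.gainP s / (M.θ - M.μ)) = M.σ := by
  rw [SoftDeadlineEq, M.integral_rateA hτ h0]

/-- The value in `SoftDeadlineEq` is strictly decreasing in the soft deadline. -/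
lemma softDeadline_value_lt {τP s t : ℝ} (hg : M.gainP τP = 0) (hs : 0 ≤ s) (hst : s < t)
    (ht : t ≤ τP) : 1 - exp (-∫ x in t..τP, M.gainP x / (M.θ - M.μ)) <
      1 - exp (-∫ x in s..τP, M.gainP x / (M.θ - M.μ)) := by
  have hq : Continuous fun x => M.gainP x / (M.θ - M.μ) := M.gainP_continuous.div_const _
  have h1 := integral_rate_pos hq (gainP_div_pos hg) hs hst ht
  have h2 := intervalIntegral.integral_add_adjacent_intervals
    (hq.intervalIntegrable (μ := volume) s t) (hq.intervalIntegrable t τP)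
  have h3 : exp (-∫ x in s..τP, M.gainP x / (M.θ - M.μ)) <
      exp (-∫ x in t..τP, M.gainP x / (M.θ - M.μ)) := exp_lt_exp.2 (by linarith)
  linarith

lemma softDeadlineEq_unique {τP s t : ℝ} (hg : M.gainP τP = 0) (hs : s ∈ Icc 0 τP)
    (ht : t ∈ Icc 0 τP) (h1 : M.SoftDeadlineEq τP s) (h2 : M.SoftDeadlineEq τP t) : s = t := by
  have h0 : 0 ≤ τP := hs.1.trans hs.2
  rw [softDeadlineEq_iff h0 hs.1] at h1
  rw [softDeadlineEq_iff h0 ht.1] at h2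
  rcases lt_trichotomy s t with h | h | h
  · have := softDeadline_value_lt hg hs.1 h ht.2
    linarith
  · exact h
  · have := softDeadline_value_lt hg ht.1 h hs.2
    linarith

/-- The properties of a beneficial equilibrium with soft deadline `τM` and hard deadline `τP`. -/
structure EquilibriumForm (M : SearchModel) (E : Profile) (τP τM : ℝ) : Prop where
  pos : 0 < τM
  lt : τM < τP
  softDeadline : M.SoftDeadlineEq τP τM
  fake_cdf : ∀ t ∈ Icc τM τP,
    E.fakeTime.cdf t = (1 / M.σ) * (1 - exp (-∫ s in τM..t, M.rateA s))
  stop_cdf : ∀ t ∈ Ico τM τP, E.stopTime.cdf t = 1 - exp (-∫ s in τM..t, M.rateP s)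
  before : ∀ t < τM, E.fakeTime.cdf t = 0 ∧ E.stopTime.cdf t = 0
  after : ∀ t ≥ τP, E.fakeTime.cdf t = 1 ∧ E.stopTime.cdf t = 1
  fake_support : E.fakeTime.support = Icc τM τP
  stop_support : E.stopTime.support = Icc τM τP
  atom : 0 < E.stopTime.atom τP
  payoffP : M.payoffP E = M.firstBestP τM
  payoffA : M.payoffA E = M.firstBestA τM
  act : ∀ t, 0 ≤ t → E.act t = 1

lemma BeneficialValues.exists_form {E : Profile} {τP V W : ℝ} (H : M.BeneficialValues E τP V W) :
    ∃ τM, M.EquilibriumForm E τP τM := by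
  obtain ⟨τ, h0, hτ, hf, hs, hV⟩ := H.exists_softDeadline
  have hσ := M.σ_pos.ne'
  have hμβ : 0 < M.μ - M.β := sub_pos.2 M.β_lt_μ
  have hqA : Continuous fun x => M.gainP x / (M.θ - M.μ) := M.gainP_continuous.div_const _
  have hqP : Continuous fun x => M.gainA x / (M.μ - M.β) := M.gainA_continuous.div_const _
  have hqPpos : ∀ x, 0 ≤ x → x < τP → 0 < M.gainA x / (M.μ - M.β) := fun x _ hx =>
    div_pos (H.gainA_pos x hx.le) hμβ
  have hfc : ∀ t ∈ Icc τ τP, E.fakeTime.cdf t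
      = (1 / M.σ) * (1 - exp (-∫ s in τ..t, M.gainP s / (M.θ - M.μ))) := fun t ht => by
    rw [← H.noFake_eq h0 hτ hf hV ht, noFake, sub_sub_cancel, ← mul_assoc,
      one_div_mul_cancel hσ, one_mul]
  have hfafter : ∀ t ≥ τP, E.fakeTime.cdf t = 1 := fun t ht => by
    refine le_antisymm (E.fakeTime.cdf_le_one t) ?_
    have h1 := E.fakeTime.law_real_univ
    have h2 : E.fakeTime.law.real (Ioi t) = 0 :=
      E.fakeTime.law_eq_zero measurableSet_Ioi fun x hx =>
        H.not_fake_of_ge (ht.trans (le_of_lt hx))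
    rw [H.fake_never, ← Iic_union_Ioi (a := t),
      measureReal_union (Iic_disjoint_Ioi le_rfl) measurableSet_Ioi, h2, ← E.fakeTime.cdf_eq] at h1
    linarith
  have hsafter : ∀ t ≥ τP, E.stopTime.cdf t = 1 := fun t ht => H.stop_cdf_of_ge ht
  have hsc : ∀ t ∈ Ico τ τP, E.stopTime.cdf t
      = 1 - exp (-∫ s in τ..t, M.gainA s / (M.μ - M.β)) := fun t ht =>
    H.stop_cdf_eq h0 hτ hf hs hV ht
  have hfbefore : ∀ t < τ, E.fakeTime.cdf t = 0 := fun t ht =>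
    BeneficialValues.cdf_eq_zero_of_not_charges hf ht
  have hsbefore : ∀ t < τ, E.stopTime.cdf t = 0 := fun t ht =>
    BeneficialValues.cdf_eq_zero_of_not_charges hs ht
  have hfmono : StrictMonoOn E.fakeTime.cdf (Icc τ τP) := fun s hs t ht hst => by
    rw [hfc s hs, hfc t ht]
    exact mul_lt_mul_of_pos_left
      (strictMonoOn_one_sub_exp hqA h0.le (gainP_div_pos H.gainP_eq) hs ht hst)
      (one_div_pos.2 M.σ_pos)
  have hsmono : StrictMonoOn E.stopTime.cdf (Icc τ τP) := fun s hs t ht hst => by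
    rcases ht.2.lt_or_eq with h | h
    · rw [hsc s ⟨hs.1, hst.trans h⟩, hsc t ⟨ht.1, h⟩]
      exact strictMonoOn_one_sub_exp hqP h0.le hqPpos hs ht hst
    · rw [h, hsafter τP le_rfl]
      exact H.stop_at_τP.1 s (h ▸ hst)
  refine ⟨τ, h0, hτ, ?_, fun t ht => ?_, fun t ht => ?_, fun t ht => ⟨hfbefore t ht, hsbefore t ht⟩,
    fun t ht => ⟨hfafter t ht, hsafter t ht⟩,
    MixedTime.support_eq_Icc hτ hfbefore hfafter hfmono,
    MixedTime.support_eq_Icc hτ hsbefore hsafter hsmono, ?_, ?_, ?_, fun t ht =>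
      H.act_eq_one h0 hτ hf hV ht⟩
  · rw [softDeadlineEq_iff H.pos.le h0.le]
    have h1 := hfc τP (right_mem_Icc.2 hτ.le)
    rw [hfafter τP le_rfl, one_div_mul_eq_div, eq_div_iff hσ] at h1
    linarith
  · rw [hfc t ht, M.integral_rateA h0.le (h0.le.trans ht.1)]
  · rw [hsc t ht, M.integral_rateP h0.le (h0.le.trans ht.1)]
  · -- the distribution function stays below one to the left of `τP`
    have h1 := E.stopTime.cdf_le_add_atom (t := τP)
      (c := 1 - exp (-∫ s in τ..τP, M.gainA s / (M.μ - M.β))) fun t ht => by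
        rcases lt_or_ge t τ with h | h
        · rw [hsbefore t h, sub_nonneg, exp_le_one_iff, neg_nonpos]
          exact (integral_rate_pos hqP hqPpos h0.le hτ le_rfl).le
        · rw [hsc t ⟨h, ht⟩]
          exact (strictMonoOn_one_sub_exp hqP h0.le hqPpos ⟨h, ht.le⟩ (right_mem_Icc.2 hτ.le) ht).le
    rw [hsafter τP le_rfl] at h1
    have h2 := exp_pos (-∫ s in τ..τP, M.gainA s / (M.μ - M.β))
    linarith
  · rw [H.payoffP_eq, ← hV τ (left_mem_Icc.2 hτ.le), H.uP_formula h0.le, M.firstBestP_eq h0.le]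
    congr 1
    rw [intervalIntegral.integral_of_le h0.le, intervalIntegral.integral_of_le h0.le,
      integral_Ioc_eq_integral_Ioo, integral_Ioc_eq_integral_Ioo]
    refine setIntegral_congr_fun measurableSet_Ioo fun x hx => ?_
    rw [BeneficialValues.waitP_of_not_charges (hf x hx.2), noFake, hfbefore x hx.2]
    ring
  · have hW : W = M.β + M.disc τ * (M.μ - M.β) + ∫ s in (0 : ℝ)..τ, M.waitA E s := by
      have h1 := H.slack_eq h0 hτ hV ⟨le_rfl, hτ⟩
      rw [slack, alive, H.stop_cdf_softDeadline h0 hτ hf hs hV] at h1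
      linarith
    have hd := M.disc_continuous
    have hh := M.haz_continuous
    have h2 : ∫ x in (0 : ℝ)..τ, M.waitA E x
        = ∫ x in (0 : ℝ)..τ, M.disc x * (M.haz x * M.μ * (1 - M.β) - M.ρ * M.β) := by
      rw [intervalIntegral.integral_of_le h0.le, intervalIntegral.integral_of_le h0.le,
        integral_Ioc_eq_integral_Ioo, integral_Ioc_eq_integral_Ioo]
      refine setIntegral_congr_fun measurableSet_Ioo fun x hx => ?_
      simp only [waitA, alive]
      rw [hsbefore x hx.2, H.act_eq_one h0 hτ hf hV hx.1.le, sub_zero, mul_one, mul_one]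
    have h4 : ∫ x in (0 : ℝ)..τ, M.disc x * M.gainA x
        = (∫ x in (0 : ℝ)..τ, M.disc x * (M.haz x * M.μ * (1 - M.β) - M.ρ * M.β))
          + (∫ x in (0 : ℝ)..τ, -((M.ρ + M.haz x) * M.disc x)) * (M.μ - M.β) := by
      rw [← intervalIntegral.integral_mul_const, ← intervalIntegral.integral_add]
      · refine intervalIntegral.integral_congr fun x _ => ?_
        simp only [gainA]; ring
      all_goals exact Continuous.intervalIntegrable (by fun_prop) _ _
    rw [M.integral_deriv_disc, M.disc_zero] at h4
    rw [H.payoffA_eq, M.firstBestA_eq h0.le, hW, h2, h4]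
    ring

lemma IsBeneficialEquilibrium.exists_form (hA1 : M.A1) (hA2 : M.A2) {τP : ℝ}
    (hτP : M.IsFirstBestDurationP τP) {E : Profile} (hE : M.IsBeneficialEquilibrium E) :
    ∃ τM, M.EquilibriumForm E τP τM := by
  obtain ⟨V, W, H⟩ := hE.exists_values hA1 hA2 hτP
  exact H.exists_form

lemma EquilibriumForm.σ_lt_sigmaBar {E : Profile} {τP τM : ℝ} (hg : M.gainP τP = 0)
    (h : M.EquilibriumForm E τP τM) : M.σ < M.sigmaBar τP := by
  have h0 : 0 ≤ τP := h.pos.le.trans h.lt.le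
  have h1 := (softDeadlineEq_iff h0 h.pos.le).1 h.softDeadline
  rw [sigmaBar, M.integral_rateA le_rfl h0]
  linarith [softDeadline_value_lt hg le_rfl h.pos h.lt.le]

lemma EquilibriumForm.unique {E E' : Profile} {τP τM : ℝ} (h : M.EquilibriumForm E τP τM)
    (h' : M.EquilibriumForm E' τP τM) :
    (∀ t, E.fakeTime.cdf t = E'.fakeTime.cdf t) ∧ (∀ t, E.stopTime.cdf t = E'.stopTime.cdf t) ∧
      ∀ t, 0 ≤ t → E.act t = E'.act t := by
  refine ⟨fun t => ?_, fun t => ?_, fun t ht => by rw [h.act t ht, h'.act t ht]⟩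
  · rcases lt_or_ge t τM with h1 | h1
    · rw [(h.before t h1).1, (h'.before t h1).1]
    rcases lt_or_ge t τP with h2 | h2
    · rw [h.fake_cdf t ⟨h1, h2.le⟩, h'.fake_cdf t ⟨h1, h2.le⟩]
    · rw [(h.after t h2).1, (h'.after t h2).1]
  · rcases lt_or_ge t τM with h1 | h1
    · rw [(h.before t h1).2, (h'.before t h1).2]
    rcases lt_or_ge t τP with h2 | h2
    · rw [h.stop_cdf t ⟨h1, h2⟩, h'.stop_cdf t ⟨h1, h2⟩]
    · rw [(h.after t h2).2, (h'.after t h2).2]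

end SearchModel

end

theorem proposition2 (M : SearchModel) (hA1 : M.A1) (hA2 : M.A2)
    (τP : ℝ) (hτP : M.IsFirstBestDurationP τP) :
    ((∃ E : Profile, M.IsBeneficialEquilibrium E) ↔ M.σ < M.sigmaBar τP) ∧
    (∀ E : Profile, M.IsBeneficialEquilibrium E →
      ∃ τM : ℝ, 0 < τM ∧ τM < τP ∧
        M.SoftDeadlineEq τP τM ∧
        (∀ τ ∈ Icc 0 τP, M.SoftDeadlineEq τP τ → τ = τM) ∧
        (∀ t ∈ Icc τM τP,
          E.fakeTime.cdf t = (1 / M.σ) * (1 - exp (-∫ s in τM..t, M.rateA s))) ∧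
        (∀ t ∈ Ico τM τP, E.stopTime.cdf t = 1 - exp (-∫ s in τM..t, M.rateP s)) ∧
        (∀ t < τM, E.fakeTime.cdf t = 0 ∧ E.stopTime.cdf t = 0) ∧
        (∀ t ≥ τP, E.fakeTime.cdf t = 1 ∧ E.stopTime.cdf t = 1) ∧
        E.fakeTime.support = Icc τM τP ∧
        E.stopTime.support = Icc τM τP ∧
        0 < E.stopTime.atom τP ∧
        M.payoffP E = M.firstBestP τM ∧
        M.payoffA E = M.firstBestA τM) ∧
    (∀ E E' : Profile, M.IsBeneficialEquilibrium E → M.IsBeneficialEquilibrium E' →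
      (∀ t, E.fakeTime.cdf t = E'.fakeTime.cdf t) ∧
      (∀ t, E.stopTime.cdf t = E'.stopTime.cdf t) ∧
      (∀ t, 0 ≤ t → E.act t = E'.act t)) := by
  obtain ⟨h0, hg⟩ := M.gainP_firstBestDuration hA1 hτP
  refine ⟨⟨fun ⟨E, hE⟩ => ?_, SearchModel.exists_beneficialEquilibrium hA2 h0 hg⟩, fun E hE => ?_,
    fun E E' hE hE' => ?_⟩
  · obtain ⟨τM, h⟩ := hE.exists_form hA1 hA2 hτP
    exact h.σ_lt_sigmaBar hg
  · obtain ⟨τM, h⟩ := hE.exists_form hA1 hA2 hτP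
    exact ⟨τM, h.pos, h.lt, h.softDeadline, fun τ hτ hs => SearchModel.softDeadlineEq_unique hg hτ
      ⟨h.pos.le, h.lt.le⟩ hs h.softDeadline, h.fake_cdf, h.stop_cdf, h.before, h.after,
      h.fake_support, h.stop_support, h.atom, h.payoffP, h.payoffA⟩
  · obtain ⟨τM, h⟩ := hE.exists_form hA1 hA2 hτP
    obtain ⟨τM', h'⟩ := hE'.exists_form hA1 hA2 hτP
    have : τM' = τM := SearchModel.softDeadlineEq_unique hg ⟨h'.pos.le, h'.lt.le⟩
      ⟨h.pos.le, h.lt.le⟩ h'.softDeadline h.softDeadline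
    exact h.unique (this ▸ h')
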